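/- Setting. Let $G$ be a network on $n$ nodes, $z\in\{0,1\}^n$ a treatment assignment, and for a node $i$ and $k\ge 0$ let $G_i^z(k)$ be the $k$-hop neighbourhood of $i$ (all nodes at graph distance at most $k$ from $i$, with the induced edges and with their treatments). Let $\gamma_0$ be a known map of such neighbourhoods into a set of features; everything is conditional on $G,z,\gamma_0$. Assume nested matching: for untreated $i,j$, $\gamma_0(G_i^z(k))=\gamma_0(G_j^z(k))$ implies $\gamma_0(G_i^z(k'))=\gamma_0(G_j^z(k'))$ for all $0\le k'\le k$. Let $n_0$ be the number of untreated nodes ($z_i=0$), let $d(k)$ be the number of distinct features $\gamma_0(G_i^z(k))$ of untreated nodes, let $X_k\in\{0,1\}^{n_0\times d(k)}$ be the matrix whose row for node $i$ is the indicator of its feature, and let $H_k$ be the orthogonal projection onto the column space of $X_k$. The outcomes of the untreated nodes are $y_{obs}=X_{k_0}\beta^0+\sigma_0u$ with $u\sim N(0,I_{n_0})$, $\sigma_0>0$, where $k_0\ge 1$ is the true neighbourhood size and $\beta^0=(f(g))_g$ consists of the values of an interference function $f$ on the features at size $k_0$. Assume identifiability: for no $k<k_0$ is $X_{k_0}\beta^0$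 in the column space of $X_k$. Put $$C_{\min}=\min_{0\le k<k_0}\ \min_{\beta}\ \frac{\|X_{k_0}\beta^0-X_k\beta\|^2}{n_0(k_0-k)}.$$ Confidence set. Let $u_1^*,\dots,u_B^*$ be i.i.d. $N(0,I_{n_0})$, independent of $u$, let $\hat k_{b,\lambda}$ be the $k$-component of a minimizer of $\|y_{obs}-X_k\beta-\sigma u_b^*\|^2+\lambda k$ over $0\le k\le n$, $\beta\in\mathbb R^{d(k)}$, $\sigma\in\mathbb R$, and let $S_B=\{\hat k_{b,\lambda}:1\le b\le B\}$. For a finite set $S$ of sizes and $Y\in\mathbb R^{n_0}$ let $\hat k_S(Y)$ be a minimizer over $k'\in S$ of $\min_\beta\|Y-X_{k'}\beta\|^2+\lambda'k'$; in both problems ties are broken by a fixed rule. Let $W_k(Y)=(H_kY,\|(I-H_k)Y\|)$, and for $w=(a,b)$ let $p_{S,k}(j\mid w)$ be the conditional probability of $\hat k_S(Y)=j$ given $W_k(Y)=w$ in the model $Y=X_k\beta+\sigma v$, $v\sim N(0,I_{n_0})$, that is (free of $\beta,\sigma$) $$p_{S,k}(j\mid w)=\mathbb P\Big(\hat k_S\Big(a+b\,\tfrac{(I-H_k)v}{\|(I-H_k)v\|}\Big)=j\Big),\qquad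 v\sim N(0,I_{n_0})$$ (with $0/0=0$). Let $\mathcal F_{S,k}(j\mid w)=\sum_{j':\,p_{S,k}(j'\mid w)\le p_{S,k}(j\mid w)}p_{S,k}(j'\mid w)$, the sum being over $0\le j'\le n$, let $\mathcal B_{S,\alpha}(k,w)=\{0\le j\le n:\mathcal F_{S,k}(j\mid w)\ge\alpha\}$, and $$\bar\Gamma_\alpha(y_{obs})=\{k\in S_B:\ \hat k_{S_B}(y_{obs})\in\mathcal B_{S_B,\alpha}(k,W_k(y_{obs}))\}.$$ Theorem. Assume $n_0-d(k_0)>4$. Then for each $\delta>0$ there are a constant $\gamma_\delta>0$ for which the interval $$\Lambda_\delta=\Big[\frac{\gamma_\delta\sigma_0^2}{\sqrt{1+\frac23\gamma_\delta^{1/4}}-1},\ n_0\gamma_\delta^{1/4}\frac{C_{\min}}6\Big]$$ has positive length, a constant $c_1>0$, and a function $r$ with $r(B)=o(e^{-c_1B})$ as $B\to\infty$, all depending only on $\delta$ and the model (that is, on $n,G,z,\gamma_0,f,k_0,\sigma_0$), such that for every $\lambda\in\Lambda_\delta$, every $\lambda'\in\mathbb R$, every $\alpha\in(0,1)$, every tie-breaking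 rule and every $B$ $$\mathbb P\big(k_0\in\bar\Gamma_\alpha(y_{obs})\big)\ge 1-\alpha-\delta-r(B).$$ -/

import Mathlib

open MeasureTheory ProbabilityTheory Filter Asymptotics

/-- A network on the nodes of an ambient vertex set of size `n`, seen from an ego node: the set of
nodes it contains, its edges, and the treatment labels (`true` means treated) of its nodes. -/
structure EgoNetwork (n : ℕ) where
  ego : Fin n
  nodes : Set (Fin n)
  graph : SimpleGraph nodes
  treat : nodes → Bool

/-- The observed data on which everything is conditioned: the interference network `G` on `n`
nodes, the treatment assignment `z`, and the known feature mapping `γ₀` of labelled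
neighbourhoods. -/
structure NetworkData (n : ℕ) (F : Type*) where
  G : SimpleGraph (Fin n)
  z : Fin n → Bool
  γ₀ : EgoNetwork n → F

noncomputable section

open scoped Classical

namespace NetworkData

variable {n : ℕ} {F : Type*} (N : NetworkData n F)

/-- The `k`-hop neighbourhood of node `i` with labelled treatments: all nodes at graph distance at
most `k` from `i` (it is the whole component of `i` once `k` exceeds the maximum depth). -/
def hop (i : Fin n) (k : ℕ) : EgoNetwork n where
  ego := i
  nodes := {j | N.G.edist i j ≤ (k : ℕ∞)}
  graph := N.G.induce {j | N.G.edist i j ≤ (k : ℕ∞)}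
  treat := fun j => N.z j

/-- The feature of node `i` for neighbourhood size `k`. -/
def feature (k : ℕ) (i : Fin n) : F := N.γ₀ (N.hop i k)

/-- The untreated nodes. -/
abbrev Untreated : Type := {i : Fin n // N.z i = false}

/-- The number of untreated nodes. -/
def n₀ : ℕ := Fintype.card N.Untreated

/-- Nested matching: nodes with the same feature at size `k` have the same feature at every smaller
size. It is only needed for untreated nodes. -/
def NestedMatching : Prop :=
  ∀ i j : N.Untreated, ∀ k : ℕ, N.feature k i = N.feature k j →
    ∀ k' : ℕ, k' ≤ k → N.feature k' i = N.feature k' j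

/-- The distinct features of the untreated nodes at neighbourhood size `k`. -/
def featureSet (k : ℕ) : Finset F := Finset.univ.image fun i : N.Untreated => N.feature k i

/-- The number of distinct features of the untreated nodes at neighbourhood size `k`. -/
def d (k : ℕ) : ℕ := (N.featureSet k).card

/-- The space of outcome vectors of the untreated nodes, with the Euclidean norm. -/
abbrev Outcome : Type := EuclideanSpace ℝ N.Untreated

/-- The space of coefficient vectors at neighbourhood size `k`. -/
abbrev Coef (k : ℕ) : Type _ := EuclideanSpace ℝ (N.featureSet k)

/-- The design matrix: the row of node `i` is the standard basis vector of its feature. -/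
def X (k : ℕ) : Matrix N.Untreated (N.featureSet k) ℝ :=
  fun i g => if N.feature k i = (g : F) then 1 else 0

/-- The product of the design matrix with a coefficient vector. -/
def fit (k : ℕ) (β : N.Coef k) : N.Outcome := (N.X k).toEuclideanLin β

/-- The orthogonal projection onto the column space of the design matrix. -/
def H (k : ℕ) : N.Outcome →L[ℝ] N.Outcome := (LinearMap.range (N.X k).toEuclideanLin).starProjection

/-- The true interference function values, for an interference function `f` and the true
neighbourhood size `k₀`. -/
def trueCoef (f : F → ℝ) (k₀ : ℕ) : N.Coef k₀ := WithLp.toLp 2 fun g => f (g : F)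

/-- The mean vector of the outcomes of the untreated nodes. -/
def mean (f : F → ℝ) (k₀ : ℕ) : N.Outcome := N.fit k₀ (N.trueCoef f k₀)

/-- Identifiability of the true neighbourhood size: it is the smallest size whose design matrix can
represent the mean vector. -/
def Identifiable (f : F → ℝ) (k₀ : ℕ) : Prop :=
  ∀ k : ℕ, k < k₀ → ¬ ∃ β : N.Coef k, N.fit k β = N.mean f k₀

/-- The separation between the true model and the under-specified models (for `1 ≤ k₀`). -/
def Cmin (f : F → ℝ) (k₀ : ℕ) : ℝ :=
  ⨅ k : Fin k₀, ⨅ β : N.Coef (k : ℕ),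
    ‖N.mean f k₀ - N.fit k β‖ ^ 2 / ((N.n₀ : ℝ) * ((k₀ : ℝ) - (k : ℕ)))

/-- The observed outcomes of the untreated nodes when the standardized error vector is `u`. -/
def yobs (f : F → ℝ) (k₀ : ℕ) (σ₀ : ℝ) (u : N.Outcome) : N.Outcome := N.mean f k₀ + σ₀ • u

/-- The penalized least-squares objective for a repro copy `u` of the error vector. -/
def reproObj (lam : ℝ) (y u : N.Outcome) (k : ℕ) (β : N.Coef k) (σ : ℝ) : ℝ :=
  ‖y - N.fit k β - σ • u‖ ^ 2 + lam * k

/-- The neighbourhood sizes `k` (between `0` and `n`) that occur in a minimizing triple `(k, β, σ)`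
of the objective. -/
def reproArgmin (lam : ℝ) (y u : N.Outcome) : Finset ℕ :=
  (Finset.range (n + 1)).filter fun k =>
    ∃ (β : N.Coef k) (σ : ℝ), ∀ k' : ℕ, k' ≤ n → ∀ (β' : N.Coef k') (σ' : ℝ),
      N.reproObj lam y u k β σ ≤ N.reproObj lam y u k' β' σ'

/-- The candidate set computed from `B` repro copies; `tie` picks one minimizer. -/
def candidateSet (tie : Finset ℕ → ℕ) (lam : ℝ) (y : N.Outcome) {B : ℕ}
    (us : Fin B → N.Outcome) : Finset ℕ :=
  Finset.univ.image fun b => tie (N.reproArgmin lam y (us b))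

/-- The minimal penalized residual sum of squares for neighbourhood size `k`. -/
def nuclearObj (lam' : ℝ) (Y : N.Outcome) (k : ℕ) : ℝ :=
  ⨅ β : N.Coef k, (‖Y - N.fit k β‖ ^ 2 + lam' * k)

/-- The nuclear statistic: the estimate of the neighbourhood size from `Y` among the candidates
`S`. -/
def khat (tie : Finset ℕ → ℕ) (lam' : ℝ) (S : Finset ℕ) (Y : N.Outcome) : ℕ :=
  tie (S.filter fun k => ∀ k' ∈ S, N.nuclearObj lam' Y k ≤ N.nuclearObj lam' Y k')

/-- The residual `(I - H_k) y`. -/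
def resid (k : ℕ) (y : N.Outcome) : N.Outcome := y - N.H k y

/-- The sufficient statistic of the model with neighbourhood size `k`. -/
def W (k : ℕ) (y : N.Outcome) : N.Outcome × ℝ := (N.H k y, ‖N.resid k y‖)

/-- An outcome vector of the model with neighbourhood size `k` whose sufficient statistic is
`w`, generated from the error vector `v`. With `v` standard Gaussian, its law is the conditional
law, given `W k Y = w`, of `Y = X_k β + σ u` with `u` standard Gaussian, for every `β` and every
`σ > 0`. -/
def reproOutcome (k : ℕ) (w : N.Outcome × ℝ) (v : N.Outcome) : N.Outcome :=
  w.1 + (w.2 / ‖N.resid k v‖) • N.resid k v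

/-- The conditional probability, in the model with neighbourhood size `k`, that the nuclear
statistic equals `j` given that the sufficient statistic equals `w` (the candidate set `S` being
held fixed). -/
def condPMF (tie : Finset ℕ → ℕ) (lam' : ℝ) (S : Finset ℕ) (k : ℕ) (w : N.Outcome × ℝ)
    (j : ℕ) : ℝ :=
  (stdGaussian N.Outcome).real {v | N.khat tie lam' S (N.reproOutcome k w v) = j}

/-- The total conditional probability of the sizes that are at most as likely as `j`. -/
def tailProb (tie : Finset ℕ → ℕ) (lam' : ℝ) (S : Finset ℕ) (k : ℕ) (w : N.Outcome × ℝ)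
    (j : ℕ) : ℝ :=
  ∑ j' ∈ (Finset.range (n + 1)).filter
      (fun j' => N.condPMF tie lam' S k w j' ≤ N.condPMF tie lam' S k w j),
    N.condPMF tie lam' S k w j'

/-- The acceptance set of level `1 - α` for the nuclear statistic. -/
def borelSet (tie : Finset ℕ → ℕ) (lam' : ℝ) (S : Finset ℕ) (α : ℝ) (k : ℕ)
    (w : N.Outcome × ℝ) : Set ℕ :=
  {j | j ≤ n ∧ α ≤ N.tailProb tie lam' S k w j}

/-- The confidence set for the neighbourhood size. -/
def confidenceSet (tie : Finset ℕ → ℕ) (lam' : ℝ) (S : Finset ℕ) (α : ℝ) (y : N.Outcome) : Set ℕ :=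
  {k | k ∈ S ∧ N.khat tie lam' S y ∈ N.borelSet tie lam' S α k (N.W k y)}

/-- The joint law of the error vector and of the `B` repro copies: all are independent standard
Gaussian vectors. -/
def jointLaw (B : ℕ) : Measure (N.Outcome × (Fin B → N.Outcome)) :=
  (stdGaussian N.Outcome).prod (Measure.pi fun _ : Fin B => stdGaussian N.Outcome)

/-- The probability that the confidence set contains the true neighbourhood size. -/
def coverage (tie : Finset ℕ → ℕ) (lam lam' α : ℝ) (f : F → ℝ) (k₀ : ℕ) (σ₀ : ℝ) (B : ℕ) : ℝ :=
  (N.jointLaw B).real {p | k₀ ∈ N.confidenceSet tie lam'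
    (N.candidateSet tie lam (N.yobs f k₀ σ₀ p.1) p.2) α (N.yobs f k₀ σ₀ p.1)}

end NetworkData

/-- The lower end of the range of the penalty level. -/
def lamLower (γ σ₀ : ℝ) : ℝ := γ * σ₀ ^ 2 / (√(1 + 2 / 3 * γ ^ (1 / 4 : ℝ)) - 1)

/-- The upper end of the range of the penalty level. -/
def lamUpper (n₀ : ℕ) (γ C : ℝ) : ℝ := n₀ * γ ^ (1 / 4 : ℝ) * (C / 6)

end

/-! For a candidate set `S` fixed in advance, the acceptance set has exact level. Given `W`, the
direction of the residual of a Gaussian outcome is uniform on the unit sphere of the orthogonal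
complement of the column space and independent of its length, so it may be resampled
(`lintegral_W_eq_lintegral_reproOutcome`). For each value of `W`, the sizes rejected by the tail
rule have total conditional probability at most `α` (`sum_filter_tail_lt_le`). The difficulty is
that the actual candidate set depends on the observed outcomes.

This dependence is removed by showing that the candidate set equals a deterministic set,
`attainable`, outside an event of small probability. One inclusion holds almost surely: if the
column space of size `k - 1` equals that of size `k`, or has codimension at most one, then size `k -
1` together with a generic repro vector fits at least as well as size `k` and pays a smaller penalty
(`reproArgmin_subset_attainable`). Conversely, for almost every outcome vector and every attainable
`k`, a nonempty open set of repro vectors makes `k` the unique minimizer, provided the penalty is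
small enough (`exists_mem_favorable`, `reproArgmin_eq_singleton`). Open sets have positive Gaussian
measure, so `B` copies miss one with exponentially small probability.

The loss `δ` pays for the outcome vectors for which the penalty is not yet small enough, or for
which the favorable probability falls below a threshold `p`. Choosing `γ` small and then `p` small
makes this event rarer than `δ`, uniformly over the penalty interval. The bounds are combined in
`coverage_ge`. -/

section StdGaussian

/-! ### Standard Gaussian measure: density, polar coordinates, resampling of directions. -/

variable {E : Type*} [NormedAddCommGroup E] [InnerProductSpace ℝ E] [FiniteDimensional ℝ E]
  [MeasurableSpace E] [BorelSpace E]

theorem integrable_exp_neg_norm_sq :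
    Integrable (fun x : E => Real.exp (-‖x‖ ^ 2 / 2)) volume := by
  have h := GaussianFourier.integrable_cexp_neg_mul_sq_norm_add (V := E) (b := 1 / 2)
    (by norm_num) 0 0
  have h2 := h.norm
  refine h2.congr (Eventually.of_forall fun x => ?_)
  simp only [Complex.norm_exp]
  congr 1
  simp [← Complex.ofReal_pow]
  ring

/-- The unnormalized Gaussian measure. -/
noncomputable def gaussWeight (E : Type*) [NormedAddCommGroup E] [InnerProductSpace ℝ E]
    [FiniteDimensional ℝ E] [MeasurableSpace E] [BorelSpace E] : Measure E :=
  volume.withDensity fun x : E => ENNReal.ofReal (Real.exp (-‖x‖ ^ 2 / 2))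

instance : IsFiniteMeasure (gaussWeight E) :=
  isFiniteMeasure_withDensity_ofReal integrable_exp_neg_norm_sq.2

theorem charFun_gaussWeight (t : E) :
    charFun (gaussWeight E) t =
      ((Real.pi : ℂ) / (1 / 2)) ^ (Module.finrank ℝ E / 2 : ℂ) * Complex.exp (-‖t‖ ^ 2 / 2) := by
  have h := GaussianFourier.integral_cexp_neg_mul_sq_norm_add (V := E) (b := 1 / 2)
    (by norm_num) Complex.I t
  rw [charFun_apply, gaussWeight, integral_withDensity_eq_integral_toReal_smul]
  rotate_left
  · fun_prop
  · simp
  convert! h using 1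
  · refine integral_congr_ae (Eventually.of_forall fun x => ?_)
    simp only
    rw [ENNReal.toReal_ofReal (Real.exp_pos _).le, Complex.real_smul, Complex.ofReal_exp,
      ← Complex.exp_add, real_inner_comm]
    congr 1
    push_cast
    ring
  · congr 2
    rw [Complex.I_sq]
    ring

/-- The two characteristic functions are proportional, and evaluation at `0` identifies the constant
with the total mass, so the Gaussian integral need not be computed. -/
theorem stdGaussian_eq_smul_gaussWeight :
    stdGaussian E = (gaussWeight E Set.univ)⁻¹ • gaussWeight E := by
  have h0 : gaussWeight E Set.univ ≠ 0 := by
    intro h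
    have h1 := charFun_gaussWeight (0 : E)
    rw [Measure.measure_univ_eq_zero.1 h] at h1
    simp only [charFun_zero, measureReal_zero_apply, Complex.ofReal_zero] at h1
    have h2 := h1.symm
    simp [Complex.cpow_eq_zero_iff, Real.pi_ne_zero] at h2
  have : IsFiniteMeasure ((gaussWeight E Set.univ)⁻¹ • gaussWeight E) :=
    ⟨by simp [ENNReal.inv_mul_cancel h0 (measure_ne_top _ _)]⟩
  refine Measure.ext_of_charFun (funext fun t => ?_)
  rw [charFun_stdGaussian]
  have hK := charFun_gaussWeight (0 : E)
  rw [charFun_zero] at hK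
  simp only [norm_zero, Complex.ofReal_zero, ne_eq, OfNat.ofNat_ne_zero, not_false_eq_true,
    zero_pow, neg_zero, zero_div, Complex.exp_zero, mul_one] at hK
  have hr : ((gaussWeight E).real Set.univ : ℂ) ≠ 0 := by
    rw [Ne, Complex.ofReal_eq_zero, measureReal_def, ENNReal.toReal_eq_zero_iff]
    simp [h0]
  rw [charFun_apply, integral_smul_measure, ← charFun_apply, charFun_gaussWeight, ← hK,
    ENNReal.toReal_inv, Complex.real_smul, ← mul_assoc, ← measureReal_def, Complex.ofReal_inv,
    inv_mul_cancel₀ hr, one_mul]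

theorem stdGaussian_absolutelyContinuous : stdGaussian E ≪ (volume : Measure E) := by
  rw [stdGaussian_eq_smul_gaussWeight]
  exact (withDensity_absolutelyContinuous _ _).smul_left _

/-- This is what turns one favorable repro vector into a positive probability of drawing such
vectors. -/
instance : (stdGaussian E).IsOpenPosMeasure where
  open_pos U hU hne h := by
    rw [stdGaussian_eq_smul_gaussWeight, Measure.smul_apply, smul_eq_mul, mul_eq_zero] at h
    have h1 : gaussWeight E U = 0 := h.resolve_left (by simp [measure_ne_top])
    have h2 : volume U = 0 := withDensity_absolutelyContinuous' (μ := (volume : Measure E))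
      (f := fun x : E => ENNReal.ofReal (Real.exp (-‖x‖ ^ 2 / 2)))
      (by fun_prop) (Eventually.of_forall fun x => by simp [Real.exp_pos]) h1
    exact hU.measure_ne_zero volume hne h2

theorem stdGaussian_submodule_eq_zero (s : Submodule ℝ E) (hs : s ≠ ⊤) :
    stdGaussian E (s : Set E) = 0 :=
  stdGaussian_absolutelyContinuous (Measure.addHaar_submodule volume s hs)

/-- Translates and multiples of a standard Gaussian vector avoid proper subspaces. -/
theorem ae_add_smul_notMem_submodule (s : Submodule ℝ E) (hs : s ≠ ⊤) (m : E) {σ : ℝ}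
    (hσ : σ ≠ 0) : ∀ᵐ u ∂(stdGaussian E), m + σ • u ∉ s := by
  have h : volume {u : E | ¬ (m + σ • u ∉ s)} = 0 := by
    have h1 : {u : E | ¬ (m + σ • u ∉ s)} =
        (fun u => σ • u) ⁻¹' ((fun u => m + u) ⁻¹' (s : Set E)) := by
      ext u; simp
    rw [h1, Measure.addHaar_preimage_smul _ hσ, measure_preimage_add,
      Measure.addHaar_submodule volume s hs, mul_zero]
  exact stdGaussian_absolutelyContinuous h

open Metric in
/-- Polar coordinates for the standard Gaussian measure. -/
theorem exists_lintegral_stdGaussian_polar [Nontrivial E] :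
    ∃ (T : Measure (sphere (0 : E) 1)) (m : Measure (Set.Ioi (0 : ℝ))), SFinite m ∧ SFinite T ∧
      ∀ F : E → ENNReal, Measurable F →
        ∫⁻ x, F x ∂(stdGaussian E) = ∫⁻ s, ∫⁻ r, F ((r : ℝ) • (s : E)) ∂m ∂T := by
  let c := (gaussWeight E Set.univ)⁻¹
  let ρ : ℝ → ENNReal := fun r => c * ENNReal.ofReal (Real.exp (-r ^ 2 / 2))
  have hρ : Measurable ρ := by fun_prop
  refine ⟨(volume : Measure E).toSphere,
    (Measure.volumeIoiPow (Module.finrank ℝ E - 1)).withDensity fun r => ρ r,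
    inferInstance, inferInstance, fun F hF => ?_⟩
  have h1 : ∫⁻ x, F x ∂(stdGaussian E) = ∫⁻ x, ρ ‖x‖ * F x := by
    rw [stdGaussian_eq_smul_gaussWeight, lintegral_smul_measure, gaussWeight,
      lintegral_withDensity_eq_lintegral_mul _ (by fun_prop) hF, smul_eq_mul,
      ← lintegral_const_mul _ (by fun_prop)]
    simp only [ρ, c, mul_assoc, Pi.mul_apply, gaussWeight]
  have hmp := (volume : Measure E).measurePreserving_homeomorphUnitSphereProd
  have h3 : ∫⁻ x : ({0}ᶜ : Set E), ρ ‖(x : E)‖ * F x ∂(Measure.comap (↑) (volume : Measure E)) =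
      ∫⁻ x, ρ ‖x‖ * F x := by
    rw [lintegral_subtype_comap (measurableSet_singleton _).compl fun x : E => ρ ‖x‖ * F x,
      MeasureTheory.restrict_compl_singleton]
  have h2 : ∫⁻ x : ({0}ᶜ : Set E), ρ ‖(x : E)‖ * F x ∂(Measure.comap (↑) (volume : Measure E)) =
      ∫⁻ p : sphere (0 : E) 1 × Set.Ioi (0 : ℝ), ρ p.2 * F ((p.2 : ℝ) • (p.1 : E))
        ∂((volume : Measure E).toSphere.prod
          (Measure.volumeIoiPow (Module.finrank ℝ E - 1))) := by
    rw [← hmp.lintegral_comp_emb (Homeomorph.measurableEmbedding _)]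
    refine lintegral_congr fun x => ?_
    have hx : ‖(x : E)‖ ≠ 0 := norm_ne_zero_iff.2 x.2
    simp [smul_smul, hx]
  rw [h1, ← h3, h2, lintegral_prod _ (by fun_prop)]
  refine lintegral_congr fun s => ?_
  rw [lintegral_withDensity_eq_lintegral_mul _ (by fun_prop) (by fun_prop)]
  rfl

/-- The direction of a standard Gaussian vector may be replaced by that of an independent copy. -/
theorem lintegral_stdGaussian_resample [Nontrivial E] {F : E → ENNReal} (hF : Measurable F) :
    ∫⁻ x, ∫⁻ y, F ((‖x‖ / ‖y‖) • y) ∂(stdGaussian E) ∂(stdGaussian E) =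
      ∫⁻ x, F x ∂(stdGaussian E) := by
  obtain ⟨T, m, _, _, h⟩ := exists_lintegral_stdGaussian_polar (E := E)
  have hone : ∫⁻ s, ∫⁻ r, (1 : ENNReal) ∂m ∂T = 1 := by
    -- `T` and `m` are not normalized separately; only the product of their masses is one. That
    -- product is the factor left over at the end.
    rw [← h (fun _ => 1) measurable_const]; simp
  simp only [lintegral_const, one_mul] at hone
  have hinner : ∀ x : E, ∫⁻ y, F ((‖x‖ / ‖y‖) • y) ∂(stdGaussian E) =
      m Set.univ * ∫⁻ s, F (‖x‖ • (s : E)) ∂T := by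
    intro x
    rw [h _ (by fun_prop), ← lintegral_const_mul _ (by fun_prop)]
    refine lintegral_congr fun s => ?_
    have : ∀ r : Set.Ioi (0 : ℝ), F ((‖x‖ / ‖(r : ℝ) • (s : E)‖) • ((r : ℝ) • (s : E))) =
        F (‖x‖ • (s : E)) := by
      intro r
      have hr : (0 : ℝ) < r := r.2
      have hs : ‖(s : E)‖ = 1 := by simp
      rw [norm_smul, hs, smul_smul, Real.norm_of_nonneg hr.le, mul_one, div_mul_cancel₀ _ hr.ne']
    simp only [this, lintegral_const]
    rw [mul_comm]
  simp only [hinner]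
  have hmeas : Measurable fun x : E => ∫⁻ s, F (‖x‖ • (s : E)) ∂T := by
    refine Measurable.lintegral_prod_right' (f := fun p : E × Metric.sphere (0 : E) 1 =>
      F (‖p.1‖ • (p.2 : E))) ?_
    fun_prop
  rw [lintegral_const_mul _ hmeas, h _ hmeas]
  have hnorm : ∀ (s : Metric.sphere (0 : E) 1) (r : Set.Ioi (0 : ℝ)),
      ‖(r : ℝ) • (s : E)‖ = r := by
    intro s r
    have hr : (0 : ℝ) < r := r.2
    rw [norm_smul, Real.norm_of_nonneg hr.le]; simp
  simp only [hnorm, lintegral_const]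
  rw [h _ hF, lintegral_lintegral_swap (by fun_prop), mul_comm _ (T _), ← mul_assoc,
    mul_comm (m _), mul_comm (T _ ) (m _), hone, one_mul]

/-- A standard Gaussian vector is the sum of independent standard Gaussian vectors in a subspace
and in its orthogonal complement. -/
theorem map_add_stdGaussian_prod (s : Submodule ℝ E) :
    ((stdGaussian s).prod (stdGaussian sᗮ)).map (fun p => (p.1 : E) + (p.2 : E)) =
      stdGaussian E := by
  have hm : Measurable fun p : s × sᗮ => (p.1 : E) + (p.2 : E) := by fun_prop
  have : IsProbabilityMeasure
      (((stdGaussian s).prod (stdGaussian sᗮ)).map (fun p => (p.1 : E) + (p.2 : E))) :=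
    Measure.isProbabilityMeasure_map hm.aemeasurable
  refine Measure.ext_of_charFun (funext fun t => ?_)
  rw [charFun_stdGaussian, charFun_apply, integral_map hm.aemeasurable (by fun_prop)]
  have h1 : ∀ p : s × sᗮ, Complex.exp ((inner ℝ ((p.1 : E) + (p.2 : E)) t : ℝ) * Complex.I) =
      Complex.exp ((inner ℝ p.1 (s.orthogonalProjectionOnto t) : ℝ) * Complex.I) *
      Complex.exp ((inner ℝ p.2 (sᗮ.orthogonalProjectionOnto t) : ℝ) * Complex.I) := by
    intro p
    rw [← Complex.exp_add, ← add_mul, inner_add_left, ← Complex.ofReal_add,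
      Submodule.inner_orthogonalProjectionOnto_eq_of_mem_left,
      Submodule.inner_orthogonalProjectionOnto_eq_of_mem_left]
  simp only [h1]
  rw [integral_prod_mul (μ := stdGaussian s) (ν := stdGaussian sᗮ)
    (f := fun a => Complex.exp ((inner ℝ a (s.orthogonalProjectionOnto t) : ℝ) * Complex.I))
    (g := fun b => Complex.exp ((inner ℝ b (sᗮ.orthogonalProjectionOnto t) : ℝ) * Complex.I)),
    ← charFun_apply, ← charFun_apply, charFun_stdGaussian, charFun_stdGaussian, ← Complex.exp_add]
  have := s.norm_sq_eq_add_norm_sq_projection t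
  congr 1
  rw [← Complex.ofReal_pow ‖t‖, this]
  push_cast
  ring

/-- The direction of the component of a standard Gaussian vector orthogonal to a proper subspace may
be replaced by that of an independent copy. -/
theorem lintegral_stdGaussian_resample_orthogonal (s : Submodule ℝ E) (hs : s ≠ ⊤)
    {Ψ : E × E → ENNReal} (hΨ : Measurable Ψ) :
    ∫⁻ u, ∫⁻ v, Ψ (s.starProjection u, (‖u - s.starProjection u‖ / ‖v - s.starProjection v‖) •
        (v - s.starProjection v)) ∂(stdGaussian E) ∂(stdGaussian E) =
      ∫⁻ u, Ψ (s.starProjection u, u - s.starProjection u) ∂(stdGaussian E) := by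
  have : Nontrivial sᗮ :=
    Submodule.nontrivial_iff_ne_bot.2 fun h => hs (Submodule.orthogonal_eq_bot_iff.1 h)
  have hadd : Measurable fun p : s × sᗮ => (p.1 : E) + (p.2 : E) := by fun_prop
  have hsplit : ∀ G : E → ENNReal, Measurable G → ∫⁻ u, G u ∂(stdGaussian E) =
      ∫⁻ a : s, ∫⁻ b : sᗮ, G ((a : E) + b) ∂(stdGaussian sᗮ) ∂(stdGaussian s) := by
    intro G hG
    rw [← map_add_stdGaussian_prod s, lintegral_map hG hadd,
      lintegral_prod (fun p : s × sᗮ => G ((p.1 : E) + p.2)) (hG.comp hadd).aemeasurable]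
  have hP : ∀ (a : s) (b : sᗮ), s.starProjection ((a : E) + b) = a := fun a b => by
    rw [map_add, Submodule.starProjection_eq_self_iff.2 a.2,
      (Submodule.starProjection_apply_eq_zero_iff _).2 b.2, add_zero]
  have hmeas : Measurable fun p : E × E => Ψ (s.starProjection p.1,
      (‖p.1 - s.starProjection p.1‖ / ‖p.2 - s.starProjection p.2‖) •
        (p.2 - s.starProjection p.2)) := by fun_prop
  rw [hsplit _ hmeas.lintegral_prod_right',
    hsplit (fun u => Ψ (s.starProjection u, u - s.starProjection u)) (by fun_prop)]
  refine lintegral_congr fun a => ?_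
  simp only [hP, add_sub_cancel_left]
  have hg : Measurable fun b : sᗮ => Ψ (a, b) := by fun_prop
  -- With the component in `s` frozen at `a`, this is the resampling identity in `sᗮ`, which is
  -- nontrivial because `s` is proper.
  rw [← lintegral_stdGaussian_resample hg]
  refine lintegral_congr fun b => ?_
  rw [hsplit _ (by fun_prop)]
  simp only [hP, add_sub_cancel_left, lintegral_const, measure_univ, mul_one]
  rfl

/-- The component of a standard Gaussian vector orthogonal to a proper subspace is nonzero. -/
theorem ae_norm_sub_starProjection_ne_zero (s : Submodule ℝ E) (hs : s ≠ ⊤) :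
    ∀ᵐ v ∂(stdGaussian E), ‖v - s.starProjection v‖ ≠ 0 := by
  filter_upwards [measure_eq_zero_iff_ae_notMem.1 (stdGaussian_submodule_eq_zero s hs)] with v hv h
  rw [norm_eq_zero, sub_eq_zero] at h
  exact hv (Submodule.starProjection_eq_self_iff.1 h.symm)

end StdGaussian

/-! ### Exact level of the acceptance set for a fixed candidate set. -/

/-- The outcomes whose tail probability is below `α` have total probability at most `α`. -/
theorem sum_filter_tail_lt_le {ι : Type*} [DecidableEq ι] (s : Finset ι) (p : ι → ℝ)
    (hp : ∀ j, 0 ≤ p j) {α : ℝ} (hα : 0 ≤ α)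
    [DecidablePred fun j => ∑ j' ∈ s with p j' ≤ p j, p j' < α] :
    ∑ j ∈ s with (∑ j' ∈ s with p j' ≤ p j, p j') < α, p j ≤ α := by
  rcases (s.filter fun j => ∑ j' ∈ s with p j' ≤ p j, p j' < α).eq_empty_or_nonempty with h | h
  · rw [h]; simpa using hα
  -- Let `m` be the most likely rejected outcome. Every rejected outcome is at most as likely, hence
  -- counted in the tail sum of `m`, which is below `α`.
  · obtain ⟨m, hm, hmax⟩ := Finset.exists_max_image _ p h
    refine le_trans ?_ (Finset.mem_filter.1 hm).2.le
    refine Finset.sum_le_sum_of_subset_of_nonneg (fun j hj => ?_) fun j _ _ => hp j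
    exact Finset.mem_filter.2 ⟨(Finset.mem_filter.1 hj).1, hmax j hj⟩

namespace NetworkData

open scoped Classical

variable {n : ℕ} {F : Type*} (N : NetworkData n F)

/-- The column space of the design matrix. -/
noncomputable abbrev colSpace (k : ℕ) : Submodule ℝ N.Outcome :=
  LinearMap.range (N.X k).toEuclideanLin

theorem fit_mem (k : ℕ) (β : N.Coef k) : N.fit k β ∈ N.colSpace k := ⟨β, rfl⟩

theorem exists_fit_eq {k : ℕ} {y : N.Outcome} (hy : y ∈ N.colSpace k) : ∃ β, N.fit k β = y := hy

theorem continuous_resid (k : ℕ) : Continuous (N.resid k) :=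
  continuous_id.sub (N.H k).continuous

theorem norm_resid_le {k : ℕ} (y : N.Outcome) {x : N.Outcome} (hx : x ∈ N.colSpace k) :
    ‖N.resid k y‖ ≤ ‖y - x‖ := by
  rw [resid, H, Submodule.starProjection_minimal]
  exact ciInf_le ⟨0, by rintro _ ⟨_, rfl⟩; exact norm_nonneg _⟩ (⟨x, hx⟩ : N.colSpace k)

theorem nuclearObj_eq (lam' : ℝ) (Y : N.Outcome) (k : ℕ) :
    N.nuclearObj lam' Y k = ‖N.resid k Y‖ ^ 2 + lam' * k := by
  obtain ⟨β₀, hβ₀⟩ := N.exists_fit_eq (k := k) (y := N.H k Y)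
    (Submodule.starProjection_apply_mem _ _)
  refine le_antisymm ?_ (le_ciInf fun β => ?_)
  · have hb : BddBelow (Set.range fun β : N.Coef k => ‖Y - N.fit k β‖ ^ 2 + lam' * k) :=
      ⟨lam' * k, by rintro _ ⟨β, rfl⟩; simp⟩
    refine (ciInf_le hb β₀).trans (le_of_eq ?_)
    simp only [hβ₀, resid]
  · have h := N.norm_resid_le Y (N.fit_mem k β)
    gcongr

theorem measurable_nuclearObj (lam' : ℝ) (k : ℕ) :
    Measurable fun Y : N.Outcome => N.nuclearObj lam' Y k := by
  simp only [nuclearObj_eq]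
  exact (((N.continuous_resid k).norm.pow 2).add continuous_const).measurable

theorem measurable_khat (tie : Finset ℕ → ℕ) (lam' : ℝ) (S : Finset ℕ) :
    Measurable (N.khat tie lam' S) := by
  refine measurable_to_countable' fun j => ?_
  -- The tie-breaking rule is arbitrary, but there are only countably many possible sets of
  -- minimizers `T`, and each occurs on a measurable set.
  have h : N.khat tie lam' S ⁻¹' {j} = ⋃ T ∈ {T : Finset ℕ | tie T = j},
      ⋂ k : ℕ, {Y | (k ∈ S ∧ ∀ k' ∈ S, N.nuclearObj lam' Y k ≤ N.nuclearObj lam' Y k') ↔ k ∈ T} := by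
    ext Y
    simp only [khat, Set.mem_preimage, Set.mem_singleton_iff, Set.mem_iUnion, Set.mem_iInter,
      Set.mem_ofPred_eq, exists_prop]
    constructor
    · intro hY
      exact ⟨_, hY, fun k => by rw [Finset.mem_filter]⟩
    · rintro ⟨T, hT, h⟩
      rw [← hT]
      congr 1
      ext k
      rw [Finset.mem_filter, h]
  have hle : ∀ k, MeasurableSet
      {Y | ∀ k' ∈ S, N.nuclearObj lam' Y k ≤ N.nuclearObj lam' Y k'} := by
    intro k
    have : {Y | ∀ k' ∈ S, N.nuclearObj lam' Y k ≤ N.nuclearObj lam' Y k'} =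
        ⋂ k' ∈ S, {Y | N.nuclearObj lam' Y k ≤ N.nuclearObj lam' Y k'} := by
      ext; simp
    rw [this]
    exact S.measurableSet_biInter fun k' _ =>
      measurableSet_le (N.measurable_nuclearObj lam' k) (N.measurable_nuclearObj lam' k')
  rw [h]
  exact MeasurableSet.biUnion (Set.to_countable _) fun T _ => MeasurableSet.iInter fun k =>
    MeasurableSet.iff (MeasurableSet.inter (.const _) (hle k)) (.const _)

theorem khat_mem {tie : Finset ℕ → ℕ} (htie : ∀ s : Finset ℕ, s.Nonempty → tie s ∈ s)
    (lam' : ℝ) {S : Finset ℕ} (hS : S.Nonempty) (Y : N.Outcome) : N.khat tie lam' S Y ∈ S := by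
  obtain ⟨m, hm, hmin⟩ := Finset.exists_min_image S (N.nuclearObj lam' Y) hS
  exact (Finset.mem_filter.1 (htie _ ⟨m, Finset.mem_filter.2 ⟨hm, hmin⟩⟩)).1

theorem measurable_reproOutcome (k : ℕ) :
    Measurable fun p : (N.Outcome × ℝ) × N.Outcome => N.reproOutcome k p.1 p.2 := by
  have := (N.continuous_resid k).measurable
  unfold reproOutcome
  fun_prop

theorem measurable_W (k : ℕ) : Measurable (N.W k) :=
  ((N.H k).continuous.prodMk (N.continuous_resid k).norm).measurable

theorem measurable_condPMF (tie : Finset ℕ → ℕ) (lam' : ℝ) (S : Finset ℕ) (k j : ℕ) :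
    Measurable fun w => N.condPMF tie lam' S k w j := by
  have h : MeasurableSet {p : (N.Outcome × ℝ) × N.Outcome |
      N.khat tie lam' S (N.reproOutcome k p.1 p.2) = j} :=
    ((N.measurable_khat tie lam' S).comp (N.measurable_reproOutcome k)) (measurableSet_singleton j)
  exact (measurable_measure_prodMk_left (ν := stdGaussian N.Outcome) h).ennreal_toReal

theorem measurable_tailProb (tie : Finset ℕ → ℕ) (lam' : ℝ) (S : Finset ℕ) (k j : ℕ) :
    Measurable fun w => N.tailProb tie lam' S k w j := by
  unfold tailProb
  simp only [Finset.sum_filter]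
  refine Finset.measurable_sum _ fun j' _ => ?_
  have h := N.measurable_condPMF tie lam' S k
  exact Measurable.ite (measurableSet_le (h j') (h j)) (h j') measurable_const

theorem measurableSet_khat_notMem_borelSet (tie : Finset ℕ → ℕ) (lam' : ℝ) (S : Finset ℕ) (α : ℝ)
    (k : ℕ) : MeasurableSet {p : (N.Outcome × ℝ) × N.Outcome |
      N.khat tie lam' S p.2 ∉ N.borelSet tie lam' S α k p.1} := by
  have h : {p : (N.Outcome × ℝ) × N.Outcome |
      N.khat tie lam' S p.2 ∉ N.borelSet tie lam' S α k p.1} =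
      ⋃ j : ℕ, {p | N.khat tie lam' S p.2 = j ∧ ¬ (j ≤ n ∧ α ≤ N.tailProb tie lam' S k p.1 j)} := by
    ext p
    simp [borelSet]
  rw [h]
  refine MeasurableSet.iUnion fun j =>
    MeasurableSet.inter ?_ (MeasurableSet.compl (.inter (.const _) ?_))
  · exact ((N.measurable_khat tie lam' S).comp measurable_snd) (measurableSet_singleton j)
  · exact measurableSet_le measurable_const
      ((N.measurable_tailProb tie lam' S k j).comp measurable_fst)

/-- For every value of the sufficient statistic, a resampled outcome falls outside the acceptance
set with probability at most `α`. -/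
theorem stdGaussian_khat_reproOutcome_notMem_le {tie : Finset ℕ → ℕ}
    (htie : ∀ s : Finset ℕ, s.Nonempty → tie s ∈ s) (lam' : ℝ) {S : Finset ℕ} (hS : S.Nonempty)
    (hSn : S ⊆ Finset.range (n + 1)) {α : ℝ} (hα : 0 ≤ α) (k : ℕ) (w : N.Outcome × ℝ) :
    stdGaussian N.Outcome {v | N.khat tie lam' S (N.reproOutcome k w v) ∉
      N.borelSet tie lam' S α k w} ≤ ENNReal.ofReal α := by
  rw [← ENNReal.ofReal_toReal (measure_ne_top (stdGaussian N.Outcome) _)]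
  refine ENNReal.ofReal_le_ofReal ?_
  change (stdGaussian N.Outcome).real _ ≤ α
  refine le_trans ?_ (sum_filter_tail_lt_le (Finset.range (n + 1)) (N.condPMF tie lam' S k w)
    (fun j => measureReal_nonneg) hα)
  refine le_trans (measureReal_mono ?_ (measure_ne_top _ _)) (measureReal_biUnion_finset_le _ _)
  intro v hv
  have hmem := hSn (N.khat_mem htie lam' hS (N.reproOutcome k w v))
  simp only [Set.mem_iUnion, exists_prop, Set.mem_ofPred_eq]
  refine ⟨_, Finset.mem_filter.2 ⟨hmem, ?_⟩, rfl⟩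
  by_contra hc
  exact hv ⟨Nat.lt_succ_iff.1 (Finset.mem_range.1 hmem), not_lt.1 hc⟩

/-- Given the sufficient statistic, an outcome vector may be replaced by a resampled one. -/
theorem lintegral_W_eq_lintegral_reproOutcome {k : ℕ} (hk : N.colSpace k ≠ ⊤) {m : N.Outcome}
    (hm : m ∈ N.colSpace k) {σ : ℝ} (hσ : 0 < σ) {Φ : (N.Outcome × ℝ) × N.Outcome → ENNReal}
    (hΦ : Measurable Φ) :
    ∫⁻ u, Φ (N.W k (m + σ • u), m + σ • u) ∂(stdGaussian N.Outcome) =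
      ∫⁻ u, ∫⁻ v, Φ (N.W k (m + σ • u), N.reproOutcome k (N.W k (m + σ • u)) v)
        ∂(stdGaussian N.Outcome) ∂(stdGaussian N.Outcome) := by
  have hWu : ∀ u, N.W k (m + σ • u) = (m + σ • N.H k u, σ * ‖N.resid k u‖) := by
    intro u
    rw [W, resid, map_add, map_smul, H, Submodule.starProjection_eq_self_iff.2 hm,
      add_sub_add_left_eq_sub, ← smul_sub, norm_smul, Real.norm_of_nonneg hσ.le, resid, H]
  let Ψ : N.Outcome × N.Outcome → ENNReal := fun p =>
    Φ ((m + σ • p.1, σ * ‖p.2‖), m + σ • p.1 + σ • p.2)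
  have hΨ : Measurable Ψ := by fun_prop
  have hL : ∀ u, Φ (N.W k (m + σ • u), m + σ • u) = Ψ (N.H k u, u - N.H k u) := by
    intro u
    simp only [Ψ, hWu, resid]
    rw [add_assoc, ← smul_add, add_sub_cancel]
  simp only [hL]
  refine (lintegral_stdGaussian_resample_orthogonal (N.colSpace k) hk hΨ).symm.trans ?_
  refine lintegral_congr fun u => lintegral_congr_ae ?_
  -- A zero residual of `v` must be excluded: only then does the rescaled residual have the same
  -- length as that of `u`.
  filter_upwards [ae_norm_sub_starProjection_ne_zero (N.colSpace k) hk] with v hv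
  rw [hWu, reproOutcome]
  simp only [Ψ, resid, H]
  rw [norm_smul, Real.norm_of_nonneg (by positivity), div_mul_cancel₀ _ hv, smul_smul,
    mul_div_assoc]

/-- Exact coverage of the acceptance set at the true neighbourhood size, for a fixed candidate
set. -/
theorem stdGaussian_khat_notMem_borelSet_le {tie : Finset ℕ → ℕ}
    (htie : ∀ s : Finset ℕ, s.Nonempty → tie s ∈ s) (lam' : ℝ) {S : Finset ℕ} (hS : S.Nonempty)
    (hSn : S ⊆ Finset.range (n + 1)) {α : ℝ} (hα : 0 ≤ α) {k : ℕ} (hk : N.colSpace k ≠ ⊤)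
    {m : N.Outcome} (hm : m ∈ N.colSpace k) {σ : ℝ} (hσ : 0 < σ) :
    stdGaussian N.Outcome {u | N.khat tie lam' S (m + σ • u) ∉
      N.borelSet tie lam' S α k (N.W k (m + σ • u))} ≤ ENNReal.ofReal α := by
  have hB := N.measurableSet_khat_notMem_borelSet tie lam' S α k
  have hW := N.measurable_W k
  have hR := N.measurable_reproOutcome k
  have hΨ : Measurable fun u : N.Outcome => (N.W k (m + σ • u), m + σ • u) :=
    (hW.comp (by fun_prop)).prodMk (by fun_prop)
  have h := N.lintegral_W_eq_lintegral_reproOutcome hk hm hσ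
    (Φ := Set.indicator {p | N.khat tie lam' S p.2 ∉ N.borelSet tie lam' S α k p.1} 1)
    (measurable_one.indicator hB)
  have h1 : stdGaussian N.Outcome {u | N.khat tie lam' S (m + σ • u) ∉
      N.borelSet tie lam' S α k (N.W k (m + σ • u))} =
      ∫⁻ u, Set.indicator {p | N.khat tie lam' S p.2 ∉ N.borelSet tie lam' S α k p.1} 1
        (N.W k (m + σ • u), m + σ • u) ∂(stdGaussian N.Outcome) := by
    exact (lintegral_indicator_one (hΨ hB)).symm
  rw [h1, h]
  calc _ ≤ ∫⁻ _, ENNReal.ofReal α ∂(stdGaussian N.Outcome) := by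
        refine lintegral_mono fun u => ?_
        set w := N.W k (m + σ • u)
        refine le_trans (le_of_eq ?_)
          (N.stdGaussian_khat_reproOutcome_notMem_le htie lam' hS hSn hα k w)
        have hΨ2 : Measurable fun v : N.Outcome => (w, N.reproOutcome k w v) :=
          measurable_const.prodMk (hR.comp measurable_prodMk_left)
        exact lintegral_indicator_one (hΨ2 hB)
    _ = ENNReal.ofReal α := by simp

end NetworkData

/-! ### Gram determinants, nested column spaces and attainable sizes. -/

/-- Strict Cauchy–Schwarz inequality. -/
theorem inner_sq_lt_of_forall_ne_smul {E : Type*} [NormedAddCommGroup E] [InnerProductSpace ℝ E]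
    {a b : E} (hb : b ≠ 0) (h : ∀ c : ℝ, a ≠ c • b) :
    (inner ℝ a b) ^ 2 < ‖a‖ ^ 2 * ‖b‖ ^ 2 := by
  have hb2 : 0 < ‖b‖ ^ 2 := by positivity
  set c := inner ℝ a b / ‖b‖ ^ 2 with hc
  have h1 : 0 < ‖a - c • b‖ ^ 2 := by
    have := norm_pos_iff.2 (sub_ne_zero.2 (h c))
    positivity
  have h2 : ‖a - c • b‖ ^ 2 * ‖b‖ ^ 2 = ‖a‖ ^ 2 * ‖b‖ ^ 2 - (inner ℝ a b) ^ 2 := by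
    rw [norm_sub_sq_real, inner_smul_right, norm_smul, mul_pow, Real.norm_eq_abs, sq_abs, hc]
    field_simp
    ring
  nlinarith [mul_pos h1 hb2]

/-- The difference of the two sides is a perfect square. The Gram determinant is thus `‖b‖ ^ 2`
times a lower bound for the squared distance from `a` to the line of `b`; leaving it undivided keeps
it continuous at `b = 0`. -/
theorem gram_le_norm_sub_smul_sq_mul {E : Type*} [NormedAddCommGroup E] [InnerProductSpace ℝ E]
    (a b : E) (c : ℝ) :
    ‖a‖ ^ 2 * ‖b‖ ^ 2 - (inner ℝ a b) ^ 2 ≤ ‖a - c • b‖ ^ 2 * ‖b‖ ^ 2 := by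
  rw [norm_sub_sq_real, inner_smul_right, norm_smul, mul_pow, Real.norm_eq_abs, sq_abs]
  nlinarith [sq_nonneg (inner ℝ a b - c * ‖b‖ ^ 2)]

theorem Submodule.sup_span_singleton_eq_top {E : Type*} [AddCommGroup E] [Module ℝ E]
    [FiniteDimensional ℝ E] {s : Submodule ℝ E} {u : E} (hu : u ∉ s)
    (hs : Module.finrank ℝ E ≤ Module.finrank ℝ s + 1) : s ⊔ ℝ ∙ u = ⊤ := by
  have hlt : s < s ⊔ ℝ ∙ u := by
    refine lt_of_le_of_ne le_sup_left fun h => hu ?_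
    rw [h]
    exact Submodule.mem_sup_right (Submodule.mem_span_singleton_self u)
  have := Submodule.finrank_lt_finrank_of_lt hlt
  exact Submodule.eq_top_of_finrank_eq (le_antisymm (Submodule.finrank_le _) (by omega))

namespace NetworkData

open scoped Classical

variable {n : ℕ} {F : Type*} (N : NetworkData n F)

theorem fit_apply (k : ℕ) (β : N.Coef k) (i : N.Untreated) :
    N.fit k β i = β ⟨N.feature k i, Finset.mem_image_of_mem _ (Finset.mem_univ i)⟩ := by
  rw [fit, Matrix.toLpLin_apply]
  simp only [Matrix.mulVec, dotProduct, X, ite_mul, one_mul, zero_mul]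
  rw [Finset.sum_eq_single ⟨N.feature k i, Finset.mem_image_of_mem _ (Finset.mem_univ i)⟩]
  · simp
  · intro g _ hg
    exact if_neg fun h => hg (Subtype.ext h.symm)
  · simp

/-- The column space consists of the outcome vectors that are constant on the feature classes. -/
theorem mem_colSpace_iff {k : ℕ} {y : N.Outcome} : y ∈ N.colSpace k ↔
    ∀ i j : N.Untreated, N.feature k i = N.feature k j → y i = y j := by
  constructor
  · rintro ⟨β, rfl⟩ i j hij
    change N.fit k β i = N.fit k β j
    rw [fit_apply, fit_apply]
    simp only [hij]
  · intro h
    have hex : ∀ g : N.featureSet k, ∃ i : N.Untreated, N.feature k i = g := fun g => by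
      obtain ⟨i, -, hi⟩ := Finset.mem_image.1 g.2
      exact ⟨i, hi⟩
    choose c hc using hex
    refine ⟨WithLp.toLp 2 fun g => y (c g), ?_⟩
    ext i
    change N.fit k _ i = y i
    rw [fit_apply]
    exact h _ _ (hc _)

/-- Nested matching says that the feature classes are refined as the size grows, so a vector
constant on the coarser classes is constant on the finer ones. -/
theorem colSpace_mono (hN : N.NestedMatching) : Monotone N.colSpace := by
  intro k k' hk y hy
  rw [mem_colSpace_iff] at hy ⊢
  exact fun i j hij => hy i j (hN i j k' hij k hk)

theorem finrank_colSpace_le (k : ℕ) : Module.finrank ℝ (N.colSpace k) ≤ N.d k := by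
  refine (LinearMap.finrank_range_le _).trans ?_
  simp [d]

theorem finrank_outcome : Module.finrank ℝ N.Outcome = N.n₀ := by
  simp [n₀]

/-- A path on `n` nodes has fewer than `n` edges, so neighbourhoods stop growing from size `n` on.
-/
theorem edist_le_iff_of_le {k k' : ℕ} (hk : n ≤ k) (hk' : n ≤ k') (i j : Fin n) :
    N.G.edist i j ≤ (k : ℕ∞) ↔ N.G.edist i j ≤ (k' : ℕ∞) := by
  by_cases h : N.G.Reachable i j
  · obtain ⟨p, hp⟩ := h.exists_isPath
    have h1 : N.G.edist i j ≤ (n : ℕ∞) := by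
      refine (SimpleGraph.edist_le p).trans ?_
      have := hp.length_lt
      rw [Fintype.card_fin] at this
      exact_mod_cast this.le
    exact iff_of_true (h1.trans (by exact_mod_cast hk)) (h1.trans (by exact_mod_cast hk'))
  · rw [SimpleGraph.edist_eq_top_of_not_reachable h]
    simp

theorem feature_eq_of_le {k k' : ℕ} (hk : n ≤ k) (hk' : n ≤ k') (i : Fin n) :
    N.feature k i = N.feature k' i := by
  have h : {j | N.G.edist i j ≤ (k : ℕ∞)} = {j | N.G.edist i j ≤ (k' : ℕ∞)} :=
    Set.ext fun j => N.edist_le_iff_of_le hk hk' i j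
  exact congrArg (fun s : Set (Fin n) => N.γ₀ ⟨i, s, N.G.induce s, fun j => N.z j⟩) h

theorem colSpace_eq_of_le {k k' : ℕ} (hk : n ≤ k) (hk' : n ≤ k') :
    N.colSpace k = N.colSpace k' := by
  ext y
  simp only [mem_colSpace_iff, N.feature_eq_of_le hk hk']

/-- The sizes that can occur in the candidate set: those whose column space is strictly larger
than the previous one, which in turn has codimension at least two. -/
noncomputable def attainable : Finset ℕ :=
  (Finset.range (n + 1)).filter fun k => k = 0 ∨
    (N.colSpace (k - 1) ≠ N.colSpace k ∧ Module.finrank ℝ (N.colSpace (k - 1)) + 2 ≤ N.n₀)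

theorem attainable_subset : N.attainable ⊆ Finset.range (n + 1) := Finset.filter_subset _ _

/-- Identifiability makes the column space grow strictly at `k₀`. This also yields `k₀ ≤ n`, since
the column spaces are constant from size `n` on. -/
theorem mem_attainable_of_identifiable (hN : N.NestedMatching) {f : F → ℝ} {k₀ : ℕ} (hk₀ : 1 ≤ k₀)
    (hid : N.Identifiable f k₀) (hd : N.d k₀ + 2 ≤ N.n₀) : k₀ ∈ N.attainable := by
  have hne : N.colSpace (k₀ - 1) ≠ N.colSpace k₀ := by
    intro h
    refine hid (k₀ - 1) (by omega) (N.exists_fit_eq ?_)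
    rw [h]
    exact N.fit_mem _ _
  refine Finset.mem_filter.2 ⟨Finset.mem_range.2 ?_, Or.inr ⟨hne, ?_⟩⟩
  · by_contra hc
    exact hne (N.colSpace_eq_of_le (by omega) (by omega))
  · have h1 := Submodule.finrank_mono (N.colSpace_mono hN (Nat.sub_le k₀ 1))
    have h2 := N.finrank_colSpace_le k₀
    omega

theorem exists_fit_add_smul_eq {k : ℕ} {u x : N.Outcome} (hx : x ∈ N.colSpace k ⊔ ℝ ∙ u) :
    ∃ (β : N.Coef k) (σ : ℝ), N.fit k β + σ • u = x := by
  obtain ⟨a, ha, b, hb, rfl⟩ := Submodule.mem_sup.1 hx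
  obtain ⟨β, rfl⟩ := N.exists_fit_eq ha
  obtain ⟨σ, rfl⟩ := Submodule.mem_span_singleton.1 hb
  exact ⟨β, σ, rfl⟩

theorem fit_add_smul_mem (k : ℕ) (β : N.Coef k) (σ : ℝ) (u : N.Outcome) :
    N.fit k β + σ • u ∈ N.colSpace k ⊔ ℝ ∙ u :=
  Submodule.add_mem_sup (N.fit_mem k β)
    (Submodule.smul_mem _ _ (Submodule.mem_span_singleton_self u))

theorem exists_reproObj_le (lam : ℝ) (y u : N.Outcome) (k : ℕ) :
    ∃ (β : N.Coef k) (σ : ℝ), ∀ (β' : N.Coef k) (σ' : ℝ),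
      N.reproObj lam y u k β σ ≤ N.reproObj lam y u k β' σ' := by
  let D := N.colSpace k ⊔ ℝ ∙ u
  obtain ⟨β, σ, h⟩ := N.exists_fit_add_smul_eq (Submodule.starProjection_apply_mem D y)
  refine ⟨β, σ, fun β' σ' => ?_⟩
  have h1 : ‖y - (N.fit k β + σ • u)‖ ≤ ‖y - (N.fit k β' + σ' • u)‖ := by
    rw [h, Submodule.starProjection_minimal]
    exact ciInf_le ⟨0, by rintro _ ⟨_, rfl⟩; exact norm_nonneg _⟩
      (⟨_, N.fit_add_smul_mem k β' σ' u⟩ : D)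
  rw [reproObj, reproObj, sub_sub, sub_sub]
  gcongr

theorem reproArgmin_nonempty (lam : ℝ) (y u : N.Outcome) : (N.reproArgmin lam y u).Nonempty := by
  choose β σ h using N.exists_reproObj_le lam y u
  obtain ⟨m, hm, hmin⟩ := Finset.exists_min_image (Finset.range (n + 1))
    (fun k => N.reproObj lam y u k (β k) (σ k)) ⟨0, by simp⟩
  refine ⟨m, Finset.mem_filter.2 ⟨hm, β m, σ m, fun k' hk' β' σ' => ?_⟩⟩
  exact (hmin k' (Finset.mem_range.2 (by omega))).trans (h k' β' σ')

/-- For error vectors in general position only attainable sizes minimize the objective. -/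
theorem reproArgmin_subset_attainable {lam : ℝ} (hlam : 0 < lam) (y : N.Outcome) {u : N.Outcome}
    (hu : ∀ k, N.colSpace k ≠ ⊤ → u ∉ N.colSpace k) :
    N.reproArgmin lam y u ⊆ N.attainable := by
  intro k hk
  obtain ⟨hkn, β, σ, hmin⟩ := Finset.mem_filter.1 hk
  refine Finset.mem_filter.2 ⟨hkn, ?_⟩
  by_contra hc
  push Not at hc
  obtain ⟨hk0, hc⟩ := hc
  have hkn' : k < n + 1 := Finset.mem_range.1 hkn
  have hcast : ((k - 1 : ℕ) : ℝ) = (k : ℝ) - 1 := by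
    rw [Nat.cast_sub (by omega), Nat.cast_one]
  -- Size `k - 1` saves `lam > 0` in the penalty, so it only has to fit no worse than size `k`.
  suffices h : ∃ (β' : N.Coef (k - 1)) (σ' : ℝ),
      ‖y - (N.fit (k - 1) β' + σ' • u)‖ ≤ ‖y - (N.fit k β + σ • u)‖ by
    obtain ⟨β', σ', h⟩ := h
    have h1 := hmin (k - 1) (by omega) β' σ'
    rw [reproObj, reproObj, sub_sub, sub_sub, hcast] at h1
    have h2 : ‖y - (N.fit (k - 1) β' + σ' • u)‖ ^ 2 ≤ ‖y - (N.fit k β + σ • u)‖ ^ 2 := by gcongr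
    linarith
  by_cases heq : N.colSpace (k - 1) = N.colSpace k
  · obtain ⟨β', hβ'⟩ := N.exists_fit_eq (k := k - 1) (y := N.fit k β) (heq ▸ N.fit_mem k β)
    exact ⟨β', σ, by rw [hβ']⟩
  · have hcod := hc heq
    -- In codimension at most one, a generic `u` completes the column space to everything and the
    -- residual vanishes.
    have htop : N.colSpace (k - 1) ⊔ ℝ ∙ u = ⊤ := by
      by_cases ht : N.colSpace (k - 1) = ⊤
      · rw [ht, top_sup_eq]
      · refine Submodule.sup_span_singleton_eq_top (hu _ ht) ?_
        rw [N.finrank_outcome]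
        omega
    obtain ⟨β', σ', h⟩ := N.exists_fit_add_smul_eq (k := k - 1) (u := u) (x := y)
      (htop ▸ Submodule.mem_top)
    exact ⟨β', σ', by rw [h, sub_self, norm_zero]; exact norm_nonneg _⟩

/-! ### Favorable repro vectors. -/

/-- The pairs of an outcome vector and an error vector for which the model of size `k` fits up to
`l` while all smaller models leave a residual of more than `L`. -/
def favorable (k : ℕ) (l L : ℝ) : Set (N.Outcome × N.Outcome) :=
  {p | (∃ (β : N.Coef k) (σ : ℝ), ‖p.1 - N.fit k β - σ • p.2‖ ^ 2 < l) ∧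
    (k ≠ 0 → L * ‖N.resid (k - 1) p.2‖ ^ 2 <
      ‖N.resid (k - 1) p.1‖ ^ 2 * ‖N.resid (k - 1) p.2‖ ^ 2 -
        (inner ℝ (N.resid (k - 1) p.1) (N.resid (k - 1) p.2)) ^ 2)}

theorem isOpen_favorable (k : ℕ) (l L : ℝ) : IsOpen (N.favorable k l L) := by
  have hc := N.continuous_resid (k - 1)
  have h1 : IsOpen {p : N.Outcome × N.Outcome |
      ∃ (β : N.Coef k) (σ : ℝ), ‖p.1 - N.fit k β - σ • p.2‖ ^ 2 < l} := by
    have : {p : N.Outcome × N.Outcome |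
        ∃ (β : N.Coef k) (σ : ℝ), ‖p.1 - N.fit k β - σ • p.2‖ ^ 2 < l} =
        ⋃ (β : N.Coef k), ⋃ (σ : ℝ), {p | ‖p.1 - N.fit k β - σ • p.2‖ ^ 2 < l} := by
      ext; simp
    rw [this]
    exact isOpen_iUnion fun β => isOpen_iUnion fun σ =>
      isOpen_lt (by fun_prop) continuous_const
  by_cases hk : k = 0
  · have : N.favorable k l L = {p : N.Outcome × N.Outcome |
        ∃ (β : N.Coef k) (σ : ℝ), ‖p.1 - N.fit k β - σ • p.2‖ ^ 2 < l} := by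
      ext; simp [favorable, hk]
    rwa [this]
  · have h2 : IsOpen {p : N.Outcome × N.Outcome | L * ‖N.resid (k - 1) p.2‖ ^ 2 <
      ‖N.resid (k - 1) p.1‖ ^ 2 * ‖N.resid (k - 1) p.2‖ ^ 2 -
        (inner ℝ (N.resid (k - 1) p.1) (N.resid (k - 1) p.2)) ^ 2} :=
      isOpen_lt (by fun_prop) (by fun_prop)
    have : N.favorable k l L = {p : N.Outcome × N.Outcome |
        ∃ (β : N.Coef k) (σ : ℝ), ‖p.1 - N.fit k β - σ • p.2‖ ^ 2 < l} ∩
        {p : N.Outcome × N.Outcome | L * ‖N.resid (k - 1) p.2‖ ^ 2 <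
      ‖N.resid (k - 1) p.1‖ ^ 2 * ‖N.resid (k - 1) p.2‖ ^ 2 -
        (inner ℝ (N.resid (k - 1) p.1) (N.resid (k - 1) p.2)) ^ 2} := by
      ext; simp [favorable, hk]
    rw [this]
    exact h1.inter h2

theorem resid_sub (k : ℕ) (x y : N.Outcome) : N.resid k (x - y) = N.resid k x - N.resid k y := by
  simp only [resid, map_sub]; abel

theorem resid_smul (k : ℕ) (c : ℝ) (x : N.Outcome) : N.resid k (c • x) = c • N.resid k x := by
  simp only [resid, map_smul, smul_sub]

theorem resid_eq_zero_iff {k : ℕ} {y : N.Outcome} : N.resid k y = 0 ↔ y ∈ N.colSpace k := by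
  rw [resid, sub_eq_zero, eq_comm, H, Submodule.starProjection_eq_self_iff]

/-- The value `lam * (k + 1)` separates size `k` from all others: size `k` stays below it because
its residual is less than `lam`, larger sizes reach it by the penalty alone, and smaller sizes
exceed it by the residual alone, as `lam * (k + 1) ≤ (n + 1) * lam ≤ L`. -/
theorem reproArgmin_eq_singleton (hN : N.NestedMatching) {lam : ℝ} {y u : N.Outcome} {k : ℕ}
    (hkn : k ≤ n) {l L : ℝ} (hl : l ≤ lam) (hlam : 0 < lam) (hL : (n + 1) * lam ≤ L)
    (h : (y, u) ∈ N.favorable k l L) : N.reproArgmin lam y u = {k} := by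
  obtain ⟨⟨β, σ, hfit⟩, hgram⟩ := h
  have hobj : N.reproObj lam y u k β σ < lam * (k + 1) := by
    rw [reproObj]; linarith
  have hother : ∀ k' : ℕ, k' ≤ n → k' ≠ k → ∀ (β' : N.Coef k') (σ' : ℝ),
      lam * (k + 1) ≤ N.reproObj lam y u k' β' σ' := by
    intro k' hk'n hne β' σ'
    rw [reproObj]
    rcases lt_or_gt_of_ne hne with hlt | hgt
    · have hR := hgram (by omega)
      set a := N.resid (k - 1) y
      set b := N.resid (k - 1) u
      have hmem : N.fit k' β' ∈ N.colSpace (k - 1) :=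
        N.colSpace_mono hN (by omega : k' ≤ k - 1) (N.fit_mem k' β')
      have h1 : ‖a - σ' • b‖ ≤ ‖y - N.fit k' β' - σ' • u‖ := by
        have := N.norm_resid_le (y - σ' • u) hmem
        rwa [resid_sub, resid_smul, sub_right_comm] at this
      have h2 : L < ‖a - σ' • b‖ ^ 2 := by
        have h3 := gram_le_norm_sub_smul_sq_mul a b σ'
        exact lt_of_mul_lt_mul_right (hR.trans_le h3) (sq_nonneg _)
      have h4 : ‖a - σ' • b‖ ^ 2 ≤ ‖y - N.fit k' β' - σ' • u‖ ^ 2 := by gcongr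
      have h5 : lam * (k + 1) ≤ (n + 1) * lam := by
        have : (k : ℝ) ≤ n := by exact_mod_cast hkn
        nlinarith
      have h6 : 0 ≤ lam * (k' : ℝ) := by positivity
      linarith
    · have h1 : ((k : ℝ) + 1) ≤ k' := by exact_mod_cast hgt
      have h2 : lam * ((k : ℝ) + 1) ≤ lam * k' := by gcongr
      have := sq_nonneg ‖y - N.fit k' β' - σ' • u‖
      linarith
  obtain ⟨m, hm⟩ := N.reproArgmin_nonempty lam y u
  refine Finset.eq_singleton_iff_nonempty_unique_mem.2 ⟨⟨m, hm⟩, fun k' hk' => ?_⟩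
  obtain ⟨hk'n, β', σ', hmin⟩ := Finset.mem_filter.1 hk'
  by_contra hne
  have h1 := hother k' (Nat.lt_succ_iff.1 (Finset.mem_range.1 hk'n)) hne β' σ'
  exact absurd (hmin k hkn β σ) (not_le.2 (hobj.trans_le h1))

theorem exists_mem_favorable_of_mem_sup {k : ℕ} {y u : N.Outcome}
    (hyu : y ∈ N.colSpace k ⊔ ℝ ∙ u)
    (hk : k ≠ 0 → u ∉ N.colSpace (k - 1) ∧ ∀ c : ℝ, y - c • u ∉ N.colSpace (k - 1)) :
    ∃ L₀ : ℝ, 0 < L₀ ∧ ∀ L < L₀, ∀ l > 0, (y, u) ∈ N.favorable k l L := by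
  obtain ⟨β, σ, hfit⟩ := N.exists_fit_add_smul_eq hyu
  have hz : ∀ l : ℝ, 0 < l → ∃ (β : N.Coef k) (σ : ℝ), ‖y - N.fit k β - σ • u‖ ^ 2 < l :=
    fun l hl => ⟨β, σ, by rw [sub_sub, hfit, sub_self]; simpa using hl⟩
  by_cases hk0 : k = 0
  · exact ⟨1, one_pos, fun L _ l hl => ⟨hz l hl, fun h => absurd hk0 h⟩⟩
  · obtain ⟨hu, hy⟩ := hk hk0
    set a := N.resid (k - 1) y with ha
    set b := N.resid (k - 1) u with hb
    have hb0 : b ≠ 0 := fun h => hu (N.resid_eq_zero_iff.1 h)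
    have hlt := inner_sq_lt_of_forall_ne_smul (a := a) hb0 fun c h => hy c <| by
      rw [← N.resid_eq_zero_iff, resid_sub, resid_smul, ← ha, ← hb, h, sub_self]
    have hb2 : 0 < ‖b‖ ^ 2 := by positivity
    refine ⟨(‖a‖ ^ 2 * ‖b‖ ^ 2 - (inner ℝ a b) ^ 2) / ‖b‖ ^ 2, div_pos (by linarith) hb2,
      fun L hL l hl => ⟨hz l hl, fun _ => ?_⟩⟩
    exact (lt_div_iff₀ hb2).1 hL

/-- For outcome vectors in general position every attainable size has favorable error vectors. -/
theorem exists_mem_favorable (hN : N.NestedMatching) {k : ℕ} (hk : k ∈ N.attainable)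
    {y : N.Outcome} (hy : ∀ k, N.colSpace k ≠ ⊤ → y ∉ N.colSpace k) :
    ∃ u : N.Outcome, ∃ L₀ : ℝ, 0 < L₀ ∧ ∀ L < L₀, ∀ l > 0, (y, u) ∈ N.favorable k l L := by
  obtain ⟨-, hk | ⟨hne, hcod⟩⟩ := Finset.mem_filter.1 hk
  · exact ⟨y, N.exists_mem_favorable_of_mem_sup
      (Submodule.mem_sup_right (Submodule.mem_span_singleton_self y)) fun h => absurd hk h⟩
  have hle : N.colSpace (k - 1) ≤ N.colSpace k := N.colSpace_mono hN (Nat.sub_le k 1)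
  -- If size `k` fits everything, `u` only has to avoid the span of the smaller column space and
  -- `y`, which is proper because the codimension is at least two. Otherwise `u = y + v`, with `v`
  -- in the larger column space but not in the smaller one: then `y = u - v` is fitted exactly by
  -- size `k`, whereas size `k - 1` cannot supply `v`.
  by_cases htop : N.colSpace k = ⊤
  · have hyk : y ∉ N.colSpace (k - 1) := hy _ (htop ▸ hne)
    have hsup : N.colSpace (k - 1) ⊔ ℝ ∙ y ≠ ⊤ := by
      intro h
      have h1 := Submodule.finrank_add_le_finrank_add_finrank (N.colSpace (k - 1)) (ℝ ∙ y)
      have h2 : Module.finrank ℝ (ℝ ∙ y) ≤ 1 :=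
        (finrank_span_le_card ({y} : Set N.Outcome)).trans (by simp)
      rw [h, finrank_top, N.finrank_outcome] at h1
      omega
    obtain ⟨u, hu⟩ := SetLike.exists_not_mem_of_ne_top _ hsup rfl
    refine ⟨u, N.exists_mem_favorable_of_mem_sup (by simp [htop]) fun _ =>
      ⟨fun h => hu (Submodule.mem_sup_left h), fun c hc => ?_⟩⟩
    have hc0 : c ≠ 0 := by
      rintro rfl
      rw [zero_smul, sub_zero] at hc
      exact hyk hc
    refine hu ?_
    have h1 : u = c⁻¹ • (-(y - c • u) + y) := by
      rw [neg_sub, sub_add_cancel, smul_smul, inv_mul_cancel₀ hc0, one_smul]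
    rw [h1]
    exact Submodule.smul_mem _ _ (Submodule.add_mem_sup (Submodule.neg_mem _ hc)
      (Submodule.mem_span_singleton_self y))
  · have hyk := hy k htop
    obtain ⟨v, hv, hv'⟩ := SetLike.exists_of_lt (lt_of_le_of_ne hle hne)
    refine ⟨y + v, N.exists_mem_favorable_of_mem_sup ?_ fun _ => ⟨fun h => hyk ?_, fun c hc => ?_⟩⟩
    · have h1 := Submodule.add_mem_sup (Submodule.neg_mem _ hv)
        (Submodule.mem_span_singleton_self (R := ℝ) (y + v))
      rwa [neg_add_eq_sub, add_sub_cancel_right] at h1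
    · simpa using Submodule.sub_mem _ (hle h) hv
    · by_cases hc1 : c = 1
      · rw [hc1, one_smul, sub_add_cancel_left] at hc
        exact hv' (by simpa using hc)
      · have h1 : (1 - c) • y ∈ N.colSpace k := by
          have h2 : (1 - c) • y = (y - c • (y + v)) + c • v := by
            rw [smul_add, sub_smul, one_smul]; abel
          rw [h2]
          exact Submodule.add_mem _ (hle hc) (Submodule.smul_mem _ _ hv)
        exact hyk ((Submodule.smul_mem_iff _ (sub_ne_zero.2 (Ne.symm hc1))).1 h1)

end NetworkData

/-! ### The penalty interval, parametrized by `γ = x ^ 4`. -/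

theorem sqrt_one_add_sub_one_ge {x : ℝ} (hx : 0 ≤ x) (hx1 : x ≤ 1) :
    x / 4 ≤ √(1 + 2 / 3 * x) - 1 := by
  have : 1 + x / 4 ≤ √(1 + 2 / 3 * x) := Real.le_sqrt_of_sq_le (by nlinarith)
  linarith

theorem pow_four_rpow_quarter {x : ℝ} (hx : 0 ≤ x) : (x ^ 4) ^ (1 / 4 : ℝ) = x := by
  rw [← Real.rpow_natCast, ← Real.rpow_mul hx]
  norm_num

theorem lamLower_pow_four_pos {x σ₀ : ℝ} (hx : 0 < x) (hσ₀ : 0 < σ₀) :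
    0 < lamLower (x ^ 4) σ₀ := by
  rw [lamLower, pow_four_rpow_quarter hx.le]
  refine div_pos (by positivity) (sub_pos.2 ?_)
  rw [Real.lt_sqrt (by norm_num)]
  linarith

theorem lamUpper_pow_four {n₀ : ℕ} {x C : ℝ} (hx : 0 ≤ x) :
    lamUpper n₀ (x ^ 4) C = n₀ * x * (C / 6) := by
  rw [lamUpper, pow_four_rpow_quarter hx]

/-- The lower end is at most `4 * σ₀ ^ 2 * x ^ 3`, while the upper end is linear in `x`, so the
interval is nondegenerate for small `x`. -/
theorem lamLower_lt_lamUpper {n₀ : ℕ} {x σ₀ C : ℝ} (hx : 0 < x) (hx1 : x ≤ 1)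
    (h : 24 * σ₀ ^ 2 * x < n₀ * C) : lamLower (x ^ 4) σ₀ < lamUpper n₀ (x ^ 4) C := by
  rw [lamUpper_pow_four hx.le, lamLower, pow_four_rpow_quarter hx.le]
  have h1 := sqrt_one_add_sub_one_ge hx.le hx1
  have h2 : 0 < x / 4 := by positivity
  calc x ^ 4 * σ₀ ^ 2 / (√(1 + 2 / 3 * x) - 1) ≤ x ^ 4 * σ₀ ^ 2 / (x / 4) :=
        div_le_div_of_nonneg_left (by positivity) h2 h1
    _ = x / 6 * (24 * σ₀ ^ 2 * x * x) := by field_simp; ring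
    _ ≤ x / 6 * (24 * σ₀ ^ 2 * x * 1) := by gcongr
    _ < x / 6 * (n₀ * C) := by rw [mul_one]; gcongr
    _ = n₀ * x * (C / 6) := by ring

/-! ### Probability of drawing favorable vectors, and coverage. -/

namespace NetworkData

open scoped Classical

variable {n : ℕ} {F : Type*} (N : NetworkData n F)

theorem Cmin_pos {f : F → ℝ} {k₀ : ℕ} (hk₀ : 1 ≤ k₀) (hid : N.Identifiable f k₀)
    (hn₀ : 0 < N.n₀) : 0 < N.Cmin f k₀ := by
  have : Nonempty (Fin k₀) := ⟨⟨0, hk₀⟩⟩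
  obtain ⟨k, hk⟩ := exists_eq_ciInf_of_finite (f := fun k : Fin k₀ => ⨅ β : N.Coef (k : ℕ),
    ‖N.mean f k₀ - N.fit k β‖ ^ 2 / ((N.n₀ : ℝ) * ((k₀ : ℝ) - (k : ℕ))))
  rw [Cmin, ← hk]
  have hkk : ((k : ℕ) : ℝ) < k₀ := by exact_mod_cast k.2
  have hden : (0 : ℝ) < (N.n₀ : ℝ) * ((k₀ : ℝ) - (k : ℕ)) :=
    mul_pos (by exact_mod_cast hn₀) (sub_pos.2 hkk)
  have hres : N.resid k (N.mean f k₀) ≠ 0 := fun h =>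
    hid k k.2 (N.exists_fit_eq (N.resid_eq_zero_iff.1 h))
  have hpos : 0 < ‖N.resid k (N.mean f k₀)‖ ^ 2 / ((N.n₀ : ℝ) * ((k₀ : ℝ) - (k : ℕ))) := by
    have := norm_pos_iff.2 hres
    positivity
  refine hpos.trans_le (le_ciInf fun β => ?_)
  have := N.norm_resid_le (N.mean f k₀) (N.fit_mem k β)
  gcongr

/-- The probability that an error vector is favorable for size `k` and outcome vector `y`. -/
noncomputable def favorableProb (k : ℕ) (l L : ℝ) (y : N.Outcome) : ENNReal :=
  stdGaussian N.Outcome (Prod.mk y ⁻¹' N.favorable k l L)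

theorem measurable_favorableProb (k : ℕ) (l L : ℝ) : Measurable (N.favorableProb k l L) :=
  measurable_measure_prodMk_left (N.isOpen_favorable k l L).measurableSet

theorem ae_forall_notMem_colSpace (m : N.Outcome) {σ : ℝ} (hσ : σ ≠ 0) :
    ∀ᵐ u ∂(stdGaussian N.Outcome), ∀ k, N.colSpace k ≠ ⊤ → m + σ • u ∉ N.colSpace k := by
  rw [ae_all_iff]
  intro k
  by_cases h : N.colSpace k = ⊤
  · exact Eventually.of_forall fun u h' => absurd h h'
  · filter_upwards [ae_add_smul_notMem_submodule (N.colSpace k) h m hσ] with u hu _ using hu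

theorem favorableProb_pos {k : ℕ} {l L : ℝ} {y u : N.Outcome} (h : (y, u) ∈ N.favorable k l L) :
    0 < N.favorableProb k l L y :=
  ((N.isOpen_favorable k l L).preimage (by fun_prop)).measure_pos _ ⟨u, h⟩

open Topology in
/-- As the residual level tends to zero, every attainable size has a positive probability of being
selected, with probability tending to one. -/
theorem tendsto_stdGaussian_exists_favorableProb_eq_zero (hN : N.NestedMatching) (m : N.Outcome)
    {σ : ℝ} (hσ : σ ≠ 0) {l L : ℕ → ℝ} (hl : ∀ i, 0 < l i) (hL : Tendsto L atTop (𝓝 0)) :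
    Tendsto (fun i => stdGaussian N.Outcome
      {u | ∃ k ∈ N.attainable, N.favorableProb k (l i) (L i) (m + σ • u) = 0}) atTop (𝓝 0) := by
  suffices h : Tendsto (fun i => stdGaussian N.Outcome
      {u | ∃ k ∈ N.attainable, N.favorableProb k (l i) (L i) (m + σ • u) = 0}) atTop
      (𝓝 (stdGaussian N.Outcome ∅)) by rwa [measure_empty] at h
  refine tendsto_measure_of_ae_tendsto_indicator_of_isFiniteMeasure atTop MeasurableSet.empty
    (fun i => ?_) ?_
  · have : {u | ∃ k ∈ N.attainable, N.favorableProb k (l i) (L i) (m + σ • u) = 0} =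
        ⋃ k ∈ N.attainable, {u | N.favorableProb k (l i) (L i) (m + σ • u) = 0} := by
      ext; simp
    rw [this]
    exact Finset.measurableSet_biUnion _ fun k _ => measurableSet_eq_fun
      ((N.measurable_favorableProb k _ _).comp (by fun_prop)) measurable_const
  · filter_upwards [N.ae_forall_notMem_colSpace m hσ] with u hu
    have : ∀ k ∈ N.attainable, ∀ᶠ i in atTop,
        N.favorableProb k (l i) (L i) (m + σ • u) ≠ 0 := by
      intro k hk
      -- The threshold `L₀` depends on `u` and `k` but not on `l`. Hence `L i → 0` suffices for each
      -- generic `u`, whatever the positive levels `l i` are.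
      obtain ⟨v, L₀, hL₀, h⟩ := N.exists_mem_favorable hN hk hu
      filter_upwards [hL.eventually_lt_const hL₀] with i hi
      exact (N.favorableProb_pos (h _ hi _ (hl i))).ne'
    filter_upwards [(eventually_all_finset _).2 this] with i hi
    refine iff_of_false ?_ (Set.notMem_empty _)
    rintro ⟨k, hk, hk0⟩
    exact hi k hk hk0

open Topology in
-- By continuity of measure: as `p` decreases to zero, the events shrink to the one where some
-- favorable probability vanishes. A threshold `p` independent of `u` is what gives a single
-- exponential rate.
theorem exists_pos_stdGaussian_favorableProb_lt (m : N.Outcome) (σ l L : ℝ) {ε : ENNReal}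
    (h : stdGaussian N.Outcome
      {u | ∃ k ∈ N.attainable, N.favorableProb k l L (m + σ • u) = 0} < ε) :
    ∃ p : ℝ, 0 < p ∧ stdGaussian N.Outcome
      {u | ∃ k ∈ N.attainable, N.favorableProb k l L (m + σ • u) < ENNReal.ofReal p} < ε := by
  have hg : ∀ k, Measurable fun u => N.favorableProb k l L (m + σ • u) := fun k =>
    (N.measurable_favorableProb k _ _).comp (by fun_prop)
  have hlim : Tendsto (fun i : ℕ => stdGaussian N.Outcome {u | ∃ k ∈ N.attainable,
      N.favorableProb k l L (m + σ • u) < ENNReal.ofReal (1 / ((i : ℝ) + 1))}) atTop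
      (𝓝 (stdGaussian N.Outcome
        {u | ∃ k ∈ N.attainable, N.favorableProb k l L (m + σ • u) = 0})) := by
    refine tendsto_measure_of_ae_tendsto_indicator_of_isFiniteMeasure atTop ?_ (fun i => ?_) ?_
    · have : {u | ∃ k ∈ N.attainable, N.favorableProb k l L (m + σ • u) = 0} =
          ⋃ k ∈ N.attainable, {u | N.favorableProb k l L (m + σ • u) = 0} := by
        ext; simp
      rw [this]
      exact Finset.measurableSet_biUnion _ fun k _ => measurableSet_eq_fun (hg k) measurable_const
    · have : {u | ∃ k ∈ N.attainable,
          N.favorableProb k l L (m + σ • u) < ENNReal.ofReal (1 / ((i : ℝ) + 1))} =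
          ⋃ k ∈ N.attainable, {u | N.favorableProb k l L (m + σ • u) <
            ENNReal.ofReal (1 / ((i : ℝ) + 1))} := by
        ext; simp
      rw [this]
      exact Finset.measurableSet_biUnion _ fun k _ => measurableSet_lt (hg k) measurable_const
    · refine Eventually.of_forall fun u => ?_
      have hp : Tendsto (fun i : ℕ => ENNReal.ofReal (1 / ((i : ℝ) + 1))) atTop (𝓝 0) := by
        simpa using ENNReal.tendsto_ofReal (tendsto_one_div_add_atTop_nhds_zero_nat (𝕜 := ℝ))
      have : ∀ k ∈ N.attainable, ∀ᶠ i : ℕ in atTop,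
          (N.favorableProb k l L (m + σ • u) < ENNReal.ofReal (1 / ((i : ℝ) + 1)) ↔
            N.favorableProb k l L (m + σ • u) = 0) := by
        intro k _
        by_cases h0 : N.favorableProb k l L (m + σ • u) = 0
        · refine Eventually.of_forall fun i => iff_of_true ?_ h0
          rw [h0]
          exact ENNReal.ofReal_pos.2 (by positivity)
        · filter_upwards [hp.eventually_lt_const (pos_iff_ne_zero.2 h0)] with i hi
          exact iff_of_false hi.not_gt h0
      filter_upwards [(eventually_all_finset _).2 this] with i hi
      exact exists_congr fun k => and_congr_right fun hk => hi k hk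
  obtain ⟨i, hi⟩ := (hlim.eventually_lt_const h).exists
  exact ⟨1 / ((i : ℝ) + 1), by positivity, hi⟩

/-- On the event that every attainable size has a favorable repro copy and that all repro copies
are in general position, the candidate set is the set of attainable sizes. -/
theorem candidateSet_eq_attainable (hN : N.NestedMatching) {tie : Finset ℕ → ℕ}
    (htie : ∀ s : Finset ℕ, s.Nonempty → tie s ∈ s) {lam l L : ℝ} (hl : l ≤ lam) (hlam : 0 < lam)
    (hL : (n + 1) * lam ≤ L) {y : N.Outcome} {B : ℕ} {us : Fin B → N.Outcome}
    (hgen : ∀ b k, N.colSpace k ≠ ⊤ → us b ∉ N.colSpace k)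
    (hfav : ∀ k ∈ N.attainable, ∃ b, (y, us b) ∈ N.favorable k l L) :
    N.candidateSet tie lam y us = N.attainable := by
  ext k
  simp only [candidateSet, Finset.mem_image, Finset.mem_univ, true_and]
  constructor
  · rintro ⟨b, rfl⟩
    exact N.reproArgmin_subset_attainable hlam y (hgen b) (htie _ (N.reproArgmin_nonempty _ _ _))
  · intro hk
    obtain ⟨b, hb⟩ := hfav k hk
    refine ⟨b, ?_⟩
    have hkn : k ≤ n := Nat.lt_succ_iff.1 (Finset.mem_range.1 (N.attainable_subset hk))
    rw [N.reproArgmin_eq_singleton hN hkn hl hlam hL hb]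
    exact Finset.mem_singleton.1 (htie {k} (Finset.singleton_nonempty k))

instance (B : ℕ) : IsProbabilityMeasure (N.jointLaw B) := by
  unfold jointLaw; infer_instance

/-- The probability that none of the repro copies is favorable, on the event that favorable copies
are not too unlikely. -/
theorem jointLaw_forall_notMem_favorable_le (B k : ℕ) (m : N.Outcome) (σ l L p : ℝ) :
    N.jointLaw B {q | ENNReal.ofReal p ≤ N.favorableProb k l L (m + σ • q.1) ∧
      ∀ b, (m + σ • q.1, q.2 b) ∉ N.favorable k l L} ≤ ENNReal.ofReal (Real.exp (-p * B)) := by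
  have hopen := (N.isOpen_favorable k l L).measurableSet
  have hmeas : MeasurableSet {q : N.Outcome × (Fin B → N.Outcome) |
      ENNReal.ofReal p ≤ N.favorableProb k l L (m + σ • q.1) ∧
      ∀ b, (m + σ • q.1, q.2 b) ∉ N.favorable k l L} := by
    have hset : {q : N.Outcome × (Fin B → N.Outcome) |
        ENNReal.ofReal p ≤ N.favorableProb k l L (m + σ • q.1) ∧
        ∀ b, (m + σ • q.1, q.2 b) ∉ N.favorable k l L} =
        {q | ENNReal.ofReal p ≤ N.favorableProb k l L (m + σ • q.1)} ∩
        ⋂ b, {q | (m + σ • q.1, q.2 b) ∈ (N.favorable k l L)ᶜ} := by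
      ext; simp
    have hg : Measurable fun q : N.Outcome × (Fin B → N.Outcome) =>
        N.favorableProb k l L (m + σ • q.1) :=
      (N.measurable_favorableProb k l L).comp
        (measurable_const.add (measurable_fst.const_smul σ))
    have hpair : ∀ b, Measurable fun q : N.Outcome × (Fin B → N.Outcome) =>
        (m + σ • q.1, q.2 b) := fun b =>
      (measurable_const.add (measurable_fst.const_smul σ)).prodMk
        ((measurable_pi_apply b).comp measurable_snd)
    rw [hset]
    exact (measurableSet_le measurable_const hg).inter
      (MeasurableSet.iInter fun b => hpair b hopen.compl)
  rw [jointLaw, Measure.prod_apply hmeas]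
  calc _ ≤ ∫⁻ _, ENNReal.ofReal (Real.exp (-p * B)) ∂(stdGaussian N.Outcome) := by
        refine lintegral_mono fun u => ?_
        by_cases hu : ENNReal.ofReal p ≤ N.favorableProb k l L (m + σ • u)
        · have hsub : Prod.mk u ⁻¹' {q : N.Outcome × (Fin B → N.Outcome) |
              ENNReal.ofReal p ≤ N.favorableProb k l L (m + σ • q.1) ∧
              ∀ b, (m + σ • q.1, q.2 b) ∉ N.favorable k l L} ⊆
              Set.univ.pi fun _ => (Prod.mk (m + σ • u) ⁻¹' N.favorable k l L)ᶜ :=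
            fun us hus b _ => hus.2 b
          refine (measure_mono hsub).trans ?_
          rw [Measure.pi_pi, Finset.prod_const, Finset.card_univ, Fintype.card_fin, neg_mul,
            mul_comm p, ← mul_neg, Real.exp_nat_mul, ENNReal.ofReal_pow (Real.exp_pos _).le]
          gcongr
          -- Each copy misses with probability at most `1 - p ≤ exp (-p)`, and the copies are
          -- independent.
          rw [prob_compl_eq_one_sub (hopen.preimage measurable_prodMk_left)]
          refine (tsub_le_tsub_left hu 1).trans ?_
          by_cases hp : 0 ≤ p
          · rw [← ENNReal.ofReal_one, ← ENNReal.ofReal_sub _ hp]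
            exact ENNReal.ofReal_le_ofReal (by linarith [Real.add_one_le_exp (-p)])
          · refine tsub_le_self.trans ?_
            rw [← ENNReal.ofReal_one]
            exact ENNReal.ofReal_le_ofReal (Real.one_le_exp (by linarith))
        · refine le_trans (le_of_eq ?_) zero_le
          convert measure_empty (μ := Measure.pi fun _ : Fin B => stdGaussian N.Outcome)
          ext us
          simp [hu]
    _ = _ := by simp

theorem ae_jointLaw_forall_notMem_colSpace (B : ℕ) :
    ∀ᵐ q ∂(N.jointLaw B), ∀ b k, N.colSpace k ≠ ⊤ → q.2 b ∉ N.colSpace k := by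
  rw [ae_all_iff]
  intro b
  have h : ∀ᵐ u ∂(stdGaussian N.Outcome), ∀ k, N.colSpace k ≠ ⊤ → u ∉ N.colSpace k := by
    simpa using N.ae_forall_notMem_colSpace 0 one_ne_zero
  exact (Measure.quasiMeasurePreserving_snd (μ := stdGaussian N.Outcome)).ae
    ((Measure.quasiMeasurePreserving_eval (fun _ : Fin B => stdGaussian N.Outcome) b).ae h)

/-- The coverage probability is at least the nominal level, up to the probability that favorable
repro copies are too unlikely and the probability that none is drawn. -/
theorem coverage_ge (hN : N.NestedMatching) {f : F → ℝ} {k₀ : ℕ} {σ₀ : ℝ} (hσ₀ : 0 < σ₀)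
    (hk₀ : k₀ ∈ N.attainable) (htop : N.colSpace k₀ ≠ ⊤) {tie : Finset ℕ → ℕ}
    (htie : ∀ s : Finset ℕ, s.Nonempty → tie s ∈ s) {lam l L : ℝ} (hl : l ≤ lam) (hlam : 0 < lam)
    (hL : (n + 1) * lam ≤ L) (lam' : ℝ) {α : ℝ} (hα : 0 ≤ α) {p δ : ℝ} (hδ : 0 ≤ δ)
    (hp : stdGaussian N.Outcome {u | ∃ k ∈ N.attainable,
      N.favorableProb k l L (N.mean f k₀ + σ₀ • u) < ENNReal.ofReal p} ≤ ENNReal.ofReal δ)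
    (B : ℕ) :
    1 - α - δ - (n + 1) * Real.exp (-p * B) ≤ N.coverage tie lam lam' α f k₀ σ₀ B := by
  set m := N.mean f k₀ with hm
  let A : Set N.Outcome := {u | ∃ k ∈ N.attainable,
    N.favorableProb k l L (m + σ₀ • u) < ENNReal.ofReal p}
  let M : Set N.Outcome := {u | N.khat tie lam' N.attainable (m + σ₀ • u) ∉
    N.borelSet tie lam' N.attainable α k₀ (N.W k₀ (m + σ₀ • u))}
  let T : ℕ → Set (N.Outcome × (Fin B → N.Outcome)) := fun k =>
    {q | ENNReal.ofReal p ≤ N.favorableProb k l L (m + σ₀ • q.1) ∧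
      ∀ b, (m + σ₀ • q.1, q.2 b) ∉ N.favorable k l L}
  let Z : Set (N.Outcome × (Fin B → N.Outcome)) :=
    {q | ¬ ∀ b k, N.colSpace k ≠ ⊤ → q.2 b ∉ N.colSpace k}
  let C : Set (N.Outcome × (Fin B → N.Outcome)) := {q | k₀ ∈ N.confidenceSet tie lam'
    (N.candidateSet tie lam (N.yobs f k₀ σ₀ q.1) q.2) α (N.yobs f k₀ σ₀ q.1)}
  -- Off the bad events the candidate set is the fixed set `N.attainable`, so failure of coverage
  -- means rejection by the fixed-set test, the event `M`. Only monotonicity and subadditivity of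
  -- the measure are applied to `C`, so its measurability plays no role.
  have hcover : Set.univ ⊆ C ∪ (M ×ˢ Set.univ ∪ (A ×ˢ Set.univ ∪
      ((⋃ k ∈ Finset.range (n + 1), T k) ∪ Z))) := by
    intro q _
    by_contra hq
    simp only [Set.mem_union, not_or, Set.mem_prod, Set.mem_univ, and_true, Set.mem_iUnion,
      not_exists] at hq
    obtain ⟨hC, hM, hA, hT, hZ⟩ := hq
    refine hC ?_
    have hS : N.candidateSet tie lam (N.yobs f k₀ σ₀ q.1) q.2 = N.attainable := by
      refine N.candidateSet_eq_attainable hN htie hl hlam hL (not_not.1 hZ) fun k hk => ?_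
      by_contra hb
      refine hT k (N.attainable_subset hk) ⟨not_lt.1 fun hlt => hA ⟨k, hk, hlt⟩, fun b hfav => ?_⟩
      exact hb ⟨b, hfav⟩
    change k₀ ∈ N.confidenceSet tie lam'
      (N.candidateSet tie lam (N.yobs f k₀ σ₀ q.1) q.2) α (N.yobs f k₀ σ₀ q.1)
    rw [hS]
    exact ⟨hk₀, not_not.1 hM⟩
  have hMle : N.jointLaw B (M ×ˢ Set.univ) ≤ ENNReal.ofReal α := by
    rw [jointLaw, Measure.prod_prod, measure_univ, mul_one]
    exact N.stdGaussian_khat_notMem_borelSet_le htie lam' ⟨k₀, hk₀⟩ N.attainable_subset hα htop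
      (N.fit_mem _ _) hσ₀
  have hAle : N.jointLaw B (A ×ˢ Set.univ) ≤ ENNReal.ofReal δ := by
    rw [jointLaw, Measure.prod_prod, measure_univ, mul_one]
    exact hp
  have hTle : N.jointLaw B (⋃ k ∈ Finset.range (n + 1), T k) ≤
      ENNReal.ofReal ((n + 1) * Real.exp (-p * B)) := by
    refine (measure_biUnion_finset_le _ _).trans ?_
    refine (Finset.sum_le_sum fun k _ =>
      N.jointLaw_forall_notMem_favorable_le B k m σ₀ l L p).trans (le_of_eq ?_)
    rw [Finset.sum_const, Finset.card_range, nsmul_eq_mul, ENNReal.ofReal_mul (by positivity)]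
    congr 1
    rw [← Nat.cast_succ, ENNReal.ofReal_natCast]
  have hZ0 : N.jointLaw B Z = 0 := N.ae_jointLaw_forall_notMem_colSpace B
  have hr : 0 ≤ ((n : ℝ) + 1) * Real.exp (-p * B) := by positivity
  have htotal : (1 : ENNReal) ≤ N.jointLaw B C + ENNReal.ofReal
      (α + (δ + (n + 1) * Real.exp (-p * B))) := by
    calc (1 : ENNReal) = N.jointLaw B Set.univ := measure_univ.symm
      _ ≤ _ := measure_mono hcover
      _ ≤ N.jointLaw B C + (N.jointLaw B (M ×ˢ Set.univ) + (N.jointLaw B (A ×ˢ Set.univ) +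
          (N.jointLaw B (⋃ k ∈ Finset.range (n + 1), T k) + N.jointLaw B Z))) := by
        refine (measure_union_le _ _).trans (add_le_add_right ?_ _)
        refine (measure_union_le _ _).trans (add_le_add_right ?_ _)
        refine (measure_union_le _ _).trans (add_le_add_right ?_ _)
        exact measure_union_le _ _
      _ ≤ _ := by
        rw [hZ0, add_zero, ENNReal.ofReal_add hα (by positivity), ENNReal.ofReal_add hδ hr]
        gcongr
  have hreal : (N.jointLaw B).real C = N.coverage tie lam lam' α f k₀ σ₀ B := rfl
  rw [← hreal]
  have h1 := ENNReal.toReal_mono (by simp [measure_ne_top]) htotal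
  rw [ENNReal.toReal_add (measure_ne_top _ _) ENNReal.ofReal_ne_top, ENNReal.toReal_one,
    ENNReal.toReal_ofReal (by positivity)] at h1
  rw [measureReal_def]
  linarith

end NetworkData

open Topology in
theorem theorem4 {n : ℕ} {F : Type*} (N : NetworkData n F) (hN : N.NestedMatching)
    (f : F → ℝ) (k₀ : ℕ) (hk₀ : 1 ≤ k₀) (σ₀ : ℝ) (hσ₀ : 0 < σ₀)
    (hid : N.Identifiable f k₀) (hd : (N.n₀ : ℤ) - (N.d k₀ : ℤ) > 4)
    (δ : ℝ) (hδ : 0 < δ) :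
    ∃ γδ : ℝ, 0 < γδ ∧ lamLower γδ σ₀ < lamUpper N.n₀ γδ (N.Cmin f k₀) ∧
      ∃ c₁ : ℝ, 0 < c₁ ∧ ∃ r : ℕ → ℝ,
        r =o[atTop] (fun B : ℕ => Real.exp (-c₁ * B)) ∧
        ∀ lam ∈ Set.Icc (lamLower γδ σ₀) (lamUpper N.n₀ γδ (N.Cmin f k₀)),
        ∀ lam' α : ℝ, 0 < α → α < 1 →
        ∀ tie : Finset ℕ → ℕ, (∀ s : Finset ℕ, s.Nonempty → tie s ∈ s) →
        ∀ B : ℕ, 1 - α - δ - r B ≤ N.coverage tie lam lam' α f k₀ σ₀ B := by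
  have hC := N.Cmin_pos hk₀ hid (by omega)
  set C := N.Cmin f k₀
  have hatt := N.mem_attainable_of_identifiable hN hk₀ hid (by omega)
  have htop : N.colSpace k₀ ≠ ⊤ := by
    intro h
    have h1 := N.finrank_colSpace_le k₀
    rw [h, finrank_top, N.finrank_outcome] at h1
    omega
  let x : ℕ → ℝ := fun i => 1 / ((i : ℝ) + 1)
  have hx : ∀ i, 0 < x i := fun i => by positivity
  have hx0 : Tendsto x atTop (𝓝 0) := tendsto_one_div_add_atTop_nhds_zero_nat
  let l : ℕ → ℝ := fun i => lamLower (x i ^ 4) σ₀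
  -- The levels `l` and `L` come from the two ends of the interval, so one favorable event serves
  -- every `lam` in it.
  let L : ℕ → ℝ := fun i => (n + 1) * lamUpper N.n₀ (x i ^ 4) C
  have hL : Tendsto L atTop (𝓝 0) := by
    have h1 : L = fun i => (n + 1) * (N.n₀ * x i * (C / 6)) :=
      funext fun i => by simp only [L, lamUpper_pow_four (hx i).le]
    rw [h1]
    have h2 := ((hx0.const_mul (N.n₀ : ℝ)).mul_const (C / 6)).const_mul ((n : ℝ) + 1)
    simpa using h2
  have hl : ∀ i, 0 < l i := fun i => lamLower_pow_four_pos (hx i) hσ₀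
  have hprob := N.tendsto_stdGaussian_exists_favorableProb_eq_zero hN (N.mean f k₀) hσ₀.ne' hl hL
  have hgap : ∀ᶠ i in atTop, 24 * σ₀ ^ 2 * x i < N.n₀ * C := by
    have h1 : Tendsto (fun i => 24 * σ₀ ^ 2 * x i) atTop (𝓝 0) := by
      simpa using hx0.const_mul (24 * σ₀ ^ 2)
    have hn₀ : (0 : ℝ) < N.n₀ := by
      have : 0 < N.n₀ := by omega
      exact_mod_cast this
    exact h1.eventually_lt_const (mul_pos hn₀ hC)
  obtain ⟨i, hi1, hi2, hi3⟩ := ((hprob.eventually_lt_const (ENNReal.ofReal_pos.2 hδ)).and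
    (hgap.and (hx0.eventually_lt_const one_pos))).exists
  obtain ⟨p, hp, hpδ⟩ := N.exists_pos_stdGaussian_favorableProb_lt _ _ _ _ hi1
  -- The remainder decays like `exp (-p * B)`; the rate `p / 2` makes it little-o.
  refine ⟨x i ^ 4, pow_pos (hx i) 4, lamLower_lt_lamUpper (hx i) hi3.le hi2, p / 2, by positivity,
    fun B => (n + 1) * Real.exp (-p * B), ?_, ?_⟩
  · refine IsLittleO.const_mul_left ?_ _
    rw [Real.isLittleO_exp_comp_exp_comp]
    have h1 : (fun B : ℕ => -(p / 2) * (B : ℝ) - -p * B) = fun B : ℕ => p / 2 * (B : ℝ) := by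
      funext B; ring
    rw [h1]
    exact tendsto_natCast_atTop_atTop.const_mul_atTop (by positivity)
  · intro lam hlam lam' α hα _ tie htie B
    exact N.coverage_ge hN hσ₀ hatt htop htie hlam.1 ((hl i).trans_le hlam.1)
      (mul_le_mul_of_nonneg_left hlam.2 (by positivity)) lam' hα.le hδ.le hpδ.le B
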